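/- Let $d\ge 1$ and $J\ge 2$, and let $\lambda_0,\dots,\lambda_{J-1}\ge 0$ with $\sum_j\lambda_j=1$. For $j=0,\dots,J-1$ let $\mu_j=\sum_{k=1}^{K_j}\pi_j^k\mu_j^k$ be a Gaussian mixture on $\mathbb R^d$, where $\pi_j^k\ge 0$, $\sum_k\pi_j^k=1$, and $\mu_j^k=\mathcal N(m_j^k,\Sigma_j^k)$ with every $\Sigma_j^k$ positive definite. Notation. $GMM_n(\infty)$ is the set of all finite Gaussian mixtures on $\mathbb R^n$ (degenerate components allowed), $\mathcal P_2(\mathbb R^d)$ is the set of probability measures with finite second moment, and $\Pi(\cdot)$ is the set of probability measures with the given marginals. Put $$W_2^2(\mu,\nu)=\inf_{\gamma\in\Pi(\mu,\nu)}\int\|x-y\|^2\,d\gamma(x,y),\qquad MW_2^2(\mu,\nu)=\inf_{\gamma\in\Pi(\mu,\nu)\cap GMM_{2d}(\infty)}\int\|x-y\|^2\,d\gamma(x,y),$$ $$mmW_2^2(\rho_0,\dots,\rho_{J-1})=\inf_{\gamma\in\Pi(\rho_0,\dots,\rho_{J-1})}\int\frac12\sum_{i,j=0}^{J-1}\lambda_i\lambda_j\|y_i-y_j\|^2\,d\gamma(y_0,\dots,y_{J-1}).$$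 A $W_2$ barycenter of $\rho_0,\dots,\rho_{J-1}$ is a minimizer of $\nu\mapsto\sum_j\lambda_jW_2^2(\rho_j,\nu)$ over $\mathcal P_2(\mathbb R^d)$. An $MW_2$ barycenter of $\mu_0,\dots,\mu_{J-1}$ is a minimizer of $\nu\mapsto\sum_j\lambda_jMW_2^2(\mu_j,\nu)$ over $GMM_d(\infty)$. The discrete multi-marginal program is to minimize $$\sum_{k_0,\dots,k_{J-1}}w_{k_0\dots k_{J-1}}\,mmW_2^2(\mu_0^{k_0},\dots,\mu_{J-1}^{k_{J-1}})$$ over all nonnegative tensors $w$ of size $K_0\times\dots\times K_{J-1}$ with $\sum_{(k_0,\dots,k_{J-1}):\,k_j=k}w_{k_0\dots k_{J-1}}=\pi_j^k$ for all $j$ and $k$. Then: 1. For all $k_0,\dots,k_{J-1}$ the components $\mu_0^{k_0},\dots,\mu_{J-1}^{k_{J-1}}$ have a unique $W_2$ barycenter $\nu_{k_0\dots k_{J-1}}$, and it is Gaussian. 2. A measure $\nu$ is an $MW_2$ barycenter of $\mu_0,\dots,\mu_{J-1}$ if and only if $$\nu=\sum_{k_0,\dots,k_{J-1}}w^*_{k_0\dots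 k_{J-1}}\,\nu_{k_0\dots k_{J-1}}$$ for some solution $w^*$ of the discrete multi-marginal program. 3. The discrete program has a solution $w^*$ with at most $K_0+\dots+K_{J-1}-J+1$ nonzero coefficients; hence there is an $MW_2$ barycenter of this form with at most that many nonzero weights. -/

import Mathlib

open MeasureTheory ProbabilityTheory
open scoped NNReal ENNReal

noncomputable section

namespace GMMOT

/-- Euclidean space `ℝ^d`, with its Euclidean norm. -/
abbrev Rd (d : ℕ) : Type := EuclideanSpace ℝ (Fin d)

/-- Gaussian mixtures with (at most) `K` components on a real topological vector space `E`
(below `E = ℝ^d` or `E = ℝ^d × ℝ^d`). The components may be degenerate and the weights may vanish. -/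
def GMM (E : Type*) [TopologicalSpace E] [AddCommMonoid E] [Module ℝ E] [MeasurableSpace E]
    (K : ℕ) : Set (Measure E) :=
  {μ | ∃ (p : Fin K → ℝ≥0) (g : Fin K → Measure E),
    ∑ k, p k = 1 ∧ (∀ k, IsGaussian (g k)) ∧ μ = ∑ k, p k • g k}

/-- All finite Gaussian mixtures on `E`. -/
def GMMInf (E : Type*) [TopologicalSpace E] [AddCommMonoid E] [Module ℝ E] [MeasurableSpace E] :
    Set (Measure E) :=
  ⋃ K : ℕ, GMM E K

/-- Probability measures on `ℝ^d` with a finite second moment. -/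
def P2 (d : ℕ) : Set (Measure (Rd d)) :=
  {μ | IsProbabilityMeasure μ ∧ ∫⁻ x, ‖x‖ₑ ^ 2 ∂μ < ∞}

/-- Probability measures on `ℝ^d × ℝ^d` with marginals `μ` and `ν`. -/
def couplings {d : ℕ} (μ ν : Measure (Rd d)) : Set (Measure (Rd d × Rd d)) :=
  {γ | IsProbabilityMeasure γ ∧ γ.map Prod.fst = μ ∧ γ.map Prod.snd = ν}

/-- Probability measures on `(ℝ^d)^J` with marginals `μ 0, …, μ (J - 1)`. -/
def multiCouplings {d J : ℕ} (μ : Fin J → Measure (Rd d)) : Set (Measure (Fin J → Rd d)) :=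
  {γ | IsProbabilityMeasure γ ∧ ∀ j, γ.map (fun y => y j) = μ j}

/-- The squared Wasserstein distance `W₂²`. -/
def W2sq {d : ℕ} (μ ν : Measure (Rd d)) : ℝ≥0∞ :=
  ⨅ γ ∈ couplings μ ν, ∫⁻ y, ‖y.1 - y.2‖ₑ ^ 2 ∂γ

/-- The squared distance `MW₂²`: the transport plans have to be Gaussian mixtures. -/
def MW2sq {d : ℕ} (μ ν : Measure (Rd d)) : ℝ≥0∞ :=
  ⨅ γ ∈ couplings μ ν ∩ GMMInf (Rd d × Rd d), ∫⁻ y, ‖y.1 - y.2‖ₑ ^ 2 ∂γ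

/-- The multi-marginal transport cost `mmW₂²` with weights `lam`. -/
def mmW2sq {d J : ℕ} (lam : Fin J → ℝ≥0) (μ : Fin J → Measure (Rd d)) : ℝ≥0∞ :=
  ⨅ γ ∈ multiCouplings μ,
    ∫⁻ y, (1 / 2) * ∑ i, ∑ j, (lam i : ℝ≥0∞) * (lam j : ℝ≥0∞) * ‖y i - y j‖ₑ ^ 2 ∂γ

/-- `ν` is a `W₂` barycenter of the `μ j` with weights `lam j`. -/
def IsW2Barycenter {d J : ℕ} (lam : Fin J → ℝ≥0) (μ : Fin J → Measure (Rd d))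
    (ν : Measure (Rd d)) : Prop :=
  ν ∈ P2 d ∧ ∀ ρ ∈ P2 d,
    ∑ j, (lam j : ℝ≥0∞) * W2sq (μ j) ν ≤ ∑ j, (lam j : ℝ≥0∞) * W2sq (μ j) ρ

/-- `ν` is an `MW₂` barycenter of the `μ j` with weights `lam j`. -/
def IsMW2Barycenter {d J : ℕ} (lam : Fin J → ℝ≥0) (μ : Fin J → Measure (Rd d))
    (ν : Measure (Rd d)) : Prop :=
  ν ∈ GMMInf (Rd d) ∧ ∀ ρ ∈ GMMInf (Rd d),
    ∑ j, (lam j : ℝ≥0∞) * MW2sq (μ j) ν ≤ ∑ j, (lam j : ℝ≥0∞) * MW2sq (μ j) ρ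

/-- Nonnegative tensors of size `K 0 × ⋯ × K (J - 1)` whose discrete marginals are the `p j`. -/
def discreteCouplings {J : ℕ} {K : Fin J → ℕ} (p : (j : Fin J) → Fin (K j) → ℝ≥0) :
    Set (((j : Fin J) → Fin (K j)) → ℝ≥0) :=
  {w | ∀ (j : Fin J) (a : Fin (K j)), ∑ k with k j = a, w k = p j a}

/-- Objective of the discrete multi-marginal program, where `g j a` is the `a`-th component of the
`j`-th mixture. -/
def discreteCost {d J : ℕ} {K : Fin J → ℕ} (lam : Fin J → ℝ≥0)
    (g : (j : Fin J) → Fin (K j) → Measure (Rd d)) (w : ((j : Fin J) → Fin (K j)) → ℝ≥0) : ℝ≥0∞ :=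
  ∑ k, (w k : ℝ≥0∞) * mmW2sq lam (fun j => g j (k j))

/-- `w` solves the discrete multi-marginal program. -/
def IsOptimalDiscrete {d J : ℕ} {K : Fin J → ℕ} (lam : Fin J → ℝ≥0)
    (p : (j : Fin J) → Fin (K j) → ℝ≥0) (g : (j : Fin J) → Fin (K j) → Measure (Rd d))
    (w : ((j : Fin J) → Fin (K j)) → ℝ≥0) : Prop :=
  w ∈ discreteCouplings p ∧
    ∀ w' ∈ discreteCouplings p, discreteCost lam g w ≤ discreteCost lam g w'

end GMMOT

end

/-! Everything reduces to a finite linear program, provided that single Gaussians are fully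
understood and that a Gaussian mixture plan between mixtures decomposes into plans between
components.

For nondegenerate Gaussians with covariances `S j`, choose factors `Y j * (Y j)ᵀ = S j` maximizing
the Frobenius norm of `A = ∑ lam i • Y i`. Orthogonal variations at the maximum show that `Aᵀ * Y j`
is positive definite when `lam j > 0` (`exists_aligned_factors`). Hence the maps `T j = Y j * A⁻¹`
are then positive definite, and `∑ lam j • T j = 1`. The law `ν` of `mb + A Z`, with `Z` standard
Gaussian and `mb` the weighted mean of the `m j`, is transported to the given Gaussians by affine
maps with linear parts `T j`. Completing the square yields quadratic Kantorovich potentials whose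
barycenter-side members have weighted sum zero. Their duality bound gives optimality of `ν` and the
value `mmW2sq`. The exact gap, bounded below by another `W2sq`, gives uniqueness
(`exists_gaussian_W2Barycenter`).

Mixture weights are identifiable (`gaussianMixture_weights_eq`), so the marginals of each component
of a Gaussian mixture plan must be components of the two mixtures whenever its weight is nonzero.
Thus `MW2sq` dominates a discrete transport cost between components. For a candidate `∑ q l • η l`,
gluing the discrete plans along `l` produces an admissible tensor. Each multi-index `k` meeting `η
l` pays at least `mmW2sq`, with equality only if `η l = ν k` (`exists_discreteCost_le_sum_MW2sq`).
Mixing the optimal Gaussian plans gives the reverse bound. Sparsity is the usual count of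
independent constraints in a linear program. -/

/-! ### Identifiability of finite Gaussian mixtures. -/

section Identifiability

open Filter Topology
open scoped RealInnerProductSpace

/-- Exponentials of distinct quadratic polynomials without constant term are linearly
independent. -/
lemma eq_zero_of_sum_mul_exp_quadratic_eq_zero {ι : Type*} (s : Finset ι) (a b c : ι → ℝ)
    (hinj : Set.InjOn (fun i => (a i, b i)) s)
    (h : ∀ t : ℝ, ∑ i ∈ s, c i * Real.exp (a i * t + b i * t ^ 2 / 2) = 0) :
    ∀ i ∈ s, c i = 0 := by
  classical
  by_contra! hne
  obtain ⟨i₁, hi₁, hci₁⟩ := hne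
  -- Lexicographic order on `(b, a)` is the order of growth at `+∞`. After division by the dominant
  -- exponential, only its own coefficient survives in the limit.
  obtain ⟨i₀, hi₀, hmax⟩ := Finset.exists_max_image (s.filter (fun i => c i ≠ 0))
    (fun i => toLex (b i, a i)) ⟨i₁, by simp [hi₁, hci₁]⟩
  rw [Finset.mem_filter] at hi₀
  have hlim : ∀ i ∈ s, Tendsto (fun t : ℝ =>
      c i * Real.exp ((a i - a i₀) * t + (b i - b i₀) * t ^ 2 / 2)) atTop
      (𝓝 (if i = i₀ then c i₀ else 0)) := by
    intro i hi
    by_cases hii : i = i₀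
    · subst hii; simp
    by_cases hc : c i = 0
    · simp [hc, hii]
    rw [if_neg hii]
    have hle := hmax i (by simp [hi, hc])
    rw [Prod.Lex.toLex_le_toLex] at hle
    rw [← mul_zero (c i)]
    refine Tendsto.const_mul _ (Real.tendsto_exp_atBot.comp ?_)
    rcases hle with hlt | ⟨heq, hle⟩
    · simp only at hlt
      have h1 : Tendsto (fun t : ℝ => t * ((a i - a i₀) + (b i - b i₀) / 2 * t)) atTop atBot := by
        refine Tendsto.atTop_mul_atBot₀ tendsto_id ?_
        refine tendsto_atBot_add_const_left _ _ ?_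
        exact Tendsto.const_mul_atTop_of_neg (by linarith) tendsto_id
      refine h1.congr fun t => by ring
    · simp only at heq hle
      have hlt : a i < a i₀ := lt_of_le_of_ne hle fun he =>
        hii (hinj hi hi₀.1 (by simp [he, heq]))
      have h1 : Tendsto (fun t : ℝ => (a i - a i₀) * t) atTop atBot :=
        Tendsto.const_mul_atTop_of_neg (by linarith) tendsto_id
      refine h1.congr fun t => by rw [heq]; ring
  have hsum := tendsto_finsetSum s hlim
  have hzero : (fun t : ℝ => ∑ i ∈ s,
      c i * Real.exp ((a i - a i₀) * t + (b i - b i₀) * t ^ 2 / 2)) = fun _ => 0 := by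
    funext t
    have := congrArg (· * Real.exp (-(a i₀ * t + b i₀ * t ^ 2 / 2))) (h t)
    simp only [zero_mul, Finset.sum_mul] at this
    rw [← this]
    refine Finset.sum_congr rfl fun i _ => ?_
    rw [mul_assoc, ← Real.exp_add]
    congr 2; ring
  rw [hzero] at hsum
  have := tendsto_nhds_unique hsum tendsto_const_nhds
  rw [Finset.sum_ite_eq' s i₀, if_pos hi₀.1] at this
  exact hi₀.2 this

lemma sum_sum_fiber_mul {ι X : Type*} [Fintype ι] [DecidableEq X] (r : ι → ℝ) (α : ι → X)
    (s : Finset X) (hs : ∀ i, α i ∈ s) (f : X → ℝ) :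
    ∑ x ∈ s, ∑ i with α i = x, r i * f x = ∑ i, r i * f (α i) := by
  rw [← Finset.sum_fiberwise_of_maps_to (t := s) (g := α) (fun i _ => hs i)]
  refine Finset.sum_congr rfl fun x _ => Finset.sum_congr rfl fun i hi => ?_
  rw [← (Finset.mem_filter.mp hi).2]

variable {E : Type*} [NormedAddCommGroup E] [InnerProductSpace ℝ E] [FiniteDimensional ℝ E]
  [MeasurableSpace E] [BorelSpace E]

/-- Finitely many distinct Gaussian measures stay distinct under projection on a suitable line. -/
lemma exists_injOn_mean_covarianceBilin (s : Finset (Measure E)) (hs : ∀ G ∈ s, IsGaussian G) :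
    ∃ t : E, Set.InjOn (fun G : Measure E => (⟪t, ∫ x, x ∂G⟫, covarianceBilin G t t)) s := by
  classical
  let U : Measure E × Measure E → Set E := fun q =>
    {t | ⟪t, ∫ x, x ∂q.1⟫ ≠ ⟪t, ∫ x, x ∂q.2⟫ ∨
      covarianceBilin q.1 t t ≠ covarianceBilin q.2 t t}
  have hopen : ∀ q, IsOpen (U q) := fun q =>
    (isOpen_ne_fun (by fun_prop) (by fun_prop)).union (isOpen_ne_fun (by fun_prop) (by fun_prop))
  have hdense : ∀ q ∈ ((s ×ˢ s).filter (fun q => q.1 ≠ q.2) : Finset _), Dense (U q) := by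
    rintro ⟨G, G'⟩ hq
    simp only [Finset.mem_filter, Finset.mem_product] at hq
    obtain ⟨⟨hG, hG'⟩, hne⟩ := hq
    have := hs G hG
    have := hs G' hG'
    intro t₀
    by_contra ht₀
    -- Otherwise means and covariances agree in all directions near `t₀`. Both differences are
    -- analytic, so they vanish everywhere, and the characteristic functions coincide.
    rw [mem_closure_iff_frequently, not_frequently] at ht₀
    have h1 : (fun t : E => ⟪t, ∫ x, x ∂G⟫ - ⟪t, ∫ x, x ∂G'⟫) =ᶠ[𝓝 t₀] 0 := by
      filter_upwards [ht₀] with t ht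
      simp only [U, Set.mem_ofPred_eq, not_or, not_not] at ht
      simp [ht.1]
    have h2 : (fun t : E => covarianceBilin G t t - covarianceBilin G' t t) =ᶠ[𝓝 t₀] 0 := by
      filter_upwards [ht₀] with t ht
      simp only [U, Set.mem_ofPred_eq, not_or, not_not] at ht
      simp [ht.2]
    have a1 : AnalyticOnNhd ℝ (fun t : E => ⟪t, ∫ x, x ∂G⟫ - ⟪t, ∫ x, x ∂G'⟫) Set.univ := by
      have (m : E) : AnalyticOnNhd ℝ (fun t : E => ⟪t, m⟫) Set.univ := fun x _ => by
        simp_rw [real_inner_comm]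
        exact (innerSL ℝ m).analyticAt x
      exact (this _).sub (this _)
    have a2 : AnalyticOnNhd ℝ
        (fun t : E => covarianceBilin G t t - covarianceBilin G' t t) Set.univ := by
      have (B : E →L[ℝ] E →L[ℝ] ℝ) : AnalyticOnNhd ℝ (fun t : E => B t t) Set.univ := fun x _ => by
        exact (B.analyticAt_bilinear (x, x)).comp (f := fun t => (t, t)) (by fun_prop)
      exact (this _).sub (this _)
    have e1 := a1.eqOn_zero_of_preconnected_of_eventuallyEq_zero isPreconnected_univ
      (Set.mem_univ t₀) h1
    have e2 := a2.eqOn_zero_of_preconnected_of_eventuallyEq_zero isPreconnected_univ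
      (Set.mem_univ t₀) h2
    refine hne (Measure.ext_of_charFun (E := E) ?_)
    funext t
    have e1' := sub_eq_zero.mp (e1 (Set.mem_univ t))
    have e2' := sub_eq_zero.mp (e2 (Set.mem_univ t))
    simp only [IsGaussian.charFun_eq', id_eq, e1', e2']
  have hD := dense_biInter_of_isOpen (f := U) (fun q _ => hopen q)
    (((s ×ˢ s).filter (fun q => q.1 ≠ q.2)).countable_toSet) (fun q hq => hdense q hq)
  obtain ⟨t, ht⟩ := hD.nonempty
  refine ⟨t, fun G hG G' hG' he => ?_⟩
  by_contra hne
  rw [Set.mem_iInter₂] at ht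
  have := ht (G, G') (by simpa [hne] using ⟨hG, hG'⟩)
  simp only [Prod.mk.injEq] at he
  rcases this with h | h
  · exact h he.1
  · exact h he.2

lemma lintegral_exp_inner_of_isGaussian (G : Measure E) [IsGaussian G] (t : E) (s : ℝ) :
    ∫⁻ x, ENNReal.ofReal (Real.exp (s * ⟪t, x⟫)) ∂G =
      ENNReal.ofReal (Real.exp (⟪t, ∫ x, x ∂G⟫ * s + covarianceBilin G t t * s ^ 2 / 2)) := by
  have hmap : G.map (fun x => ⟪t, x⟫) =
      gaussianReal ⟪t, ∫ x, x ∂G⟫ (covarianceBilin G t t).toNNReal := by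
    have := IsGaussian.map_eq_gaussianReal (μ := G) (innerSL ℝ t)
    rw [IsGaussian.integral_dual] at this
    rw [covarianceBilin_self IsGaussian.memLp_two_id]
    exact this
  have hnn : 0 ≤ covarianceBilin G t t := by
    rw [covarianceBilin_self IsGaussian.memLp_two_id]; exact variance_nonneg _ _
  have hm := mgf_gaussianReal hmap s
  rw [Real.coe_toNNReal _ hnn] at hm
  rw [← hm, mgf, ofReal_integral_eq_lintegral_ofReal]
  · have := integrable_exp_mul_gaussianReal (μ := ⟪t, ∫ x, x ∂G⟫)
      (v := (covarianceBilin G t t).toNNReal) s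
    rw [← hmap] at this
    exact this.comp_measurable (by fun_prop)
  · exact Eventually.of_forall fun x => (Real.exp_pos _).le

/-- The moment generating function of a Gaussian measure in the direction `t`. -/
noncomputable def gaussianMgf (t : E) (G : Measure E) (u : ℝ) : ℝ :=
  Real.exp (⟪t, ∫ x, x ∂G⟫ * u + covarianceBilin G t t * u ^ 2 / 2)

lemma lintegral_exp_inner_gaussianMixture {ι : Type*} [Fintype ι] (r : ι → ℝ≥0)
    (α : ι → Measure E) (hα : ∀ i, IsGaussian (α i)) (t : E) (u : ℝ) :
    ∫⁻ x, ENNReal.ofReal (Real.exp (u * ⟪t, x⟫)) ∂(∑ i, r i • α i) =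
      ENNReal.ofReal (∑ i, (r i : ℝ) * gaussianMgf t (α i) u) := by
  rw [lintegral_finsetSum_measure, ENNReal.ofReal_sum_of_nonneg
    (fun i _ => by unfold gaussianMgf; positivity)]
  refine Finset.sum_congr rfl fun i _ => ?_
  have := hα i
  rw [lintegral_smul_measure, lintegral_exp_inner_of_isGaussian,
    ENNReal.ofReal_mul (r i).coe_nonneg, ENNReal.ofReal_coe_nnreal]
  rfl

/-- Gaussian mixtures are identifiable: a mixture determines the total weight of each Gaussian
component, degenerate components included. -/
theorem gaussianMixture_weights_eq {ι κ : Type*} [Fintype ι] [Fintype κ]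
    (r : ι → ℝ≥0) (α : ι → Measure E) (p : κ → ℝ≥0) (g : κ → Measure E)
    (hα : ∀ i, IsGaussian (α i)) (hg : ∀ a, IsGaussian (g a))
    (h : ∑ i, r i • α i = ∑ a, p a • g a) [DecidableEq (Measure E)] (G : Measure E) :
    ∑ i with α i = G, r i = ∑ a with g a = G, p a := by
  set s : Finset (Measure E) := Finset.univ.image α ∪ Finset.univ.image g with hs
  have hαs : ∀ i, α i ∈ s := fun i => by simp [hs]
  have hgs : ∀ a, g a ∈ s := fun a => by simp [hs]
  have hsG : ∀ G ∈ s, IsGaussian G := by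
    intro G hG
    simp only [hs, Finset.mem_union, Finset.mem_image, Finset.mem_univ, true_and] at hG
    rcases hG with ⟨i, rfl⟩ | ⟨a, rfl⟩
    · exact hα i
    · exact hg a
  obtain ⟨t, ht⟩ := exists_injOn_mean_covarianceBilin s hsG
  have hmgf : ∀ u : ℝ, ∑ i, (r i : ℝ) * gaussianMgf t (α i) u =
      ∑ a, (p a : ℝ) * gaussianMgf t (g a) u := by
    intro u
    have hu := lintegral_exp_inner_gaussianMixture r α hα t u
    rw [h, lintegral_exp_inner_gaussianMixture p g hg t u] at hu
    exact ((ENNReal.ofReal_eq_ofReal_iff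
      (Finset.sum_nonneg fun i _ => mul_nonneg (p i).2 (Real.exp_pos _).le)
      (Finset.sum_nonneg fun i _ => mul_nonneg (r i).2 (Real.exp_pos _).le)).mp hu).symm
  have hzero := eq_zero_of_sum_mul_exp_quadratic_eq_zero s (fun G => ⟪t, ∫ x, x ∂G⟫)
    (fun G => covarianceBilin G t t)
    (fun G => ∑ i with α i = G, (r i : ℝ) - ∑ a with g a = G, (p a : ℝ)) ht (fun u => by
      simp only [sub_mul, Finset.sum_mul, Finset.sum_sub_distrib]
      rw [sub_eq_zero]
      exact (sum_sum_fiber_mul _ α s hαs (gaussianMgf t · u)).trans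
        ((hmgf u).trans (sum_sum_fiber_mul _ g s hgs (gaussianMgf t · u)).symm))
  by_cases hG : G ∈ s
  · have := sub_eq_zero.mp (hzero G hG)
    exact_mod_cast this
  · rw [Finset.sum_eq_zero, Finset.sum_eq_zero]
    · intro a ha
      exact absurd ((Finset.mem_filter.mp ha).2 ▸ hgs a) hG
    · intro a ha
      exact absurd ((Finset.mem_filter.mp ha).2 ▸ hαs a) hG

end Identifiability

/-! ### Orthogonal variations and aligned square roots. -/

section Procrustes

open Matrix
open scoped MatrixOrder

lemma trace_mul_vecMulVec {n : Type*} [Fintype n] (M : Matrix n n ℝ) (u v : n → ℝ) :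
    (M * vecMulVec u v).trace = v ⬝ᵥ M *ᵥ u := by
  rw [mul_vecMulVec, trace_vecMulVec, dotProduct_comm]

variable {n : Type*} [Fintype n] [DecidableEq n]

/-- The matrix of the orthogonal reflection in the hyperplane orthogonal to `u`. -/
noncomputable def householder (u : n → ℝ) : Matrix n n ℝ :=
  1 - (2 / (u ⬝ᵥ u)) • vecMulVec u u

lemma householder_mem_orthogonalGroup {u : n → ℝ} (hu : u ⬝ᵥ u ≠ 0) :
    householder u ∈ orthogonalGroup n ℝ := by
  rw [mem_orthogonalGroup_iff]
  have hsymm : (householder u)ᵀ = householder u := by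
    simp [householder, transpose_vecMulVec]
  rw [hsymm, householder]
  have hsq : vecMulVec u u * vecMulVec u u = (u ⬝ᵥ u) • vecMulVec u u := by
    rw [vecMulVec_mul_vecMulVec, vecMulVec_smul]
  rw [sub_mul, mul_sub, mul_sub, smul_mul_smul_comm, hsq, smul_smul]
  simp only [mul_one, one_mul]
  have : 2 / (u ⬝ᵥ u) * (2 / (u ⬝ᵥ u)) * (u ⬝ᵥ u) = 2 / (u ⬝ᵥ u) + 2 / (u ⬝ᵥ u) := by
    field_simp; ring
  rw [this, add_smul]
  abel

lemma trace_mul_householder (M : Matrix n n ℝ) (u : n → ℝ) :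
    (M * householder u).trace = M.trace - 2 / (u ⬝ᵥ u) * (u ⬝ᵥ M *ᵥ u) := by
  rw [householder, mul_sub, mul_one, trace_sub, mul_smul_comm, trace_smul, trace_mul_vecMulVec,
    smul_eq_mul]

/-- Single reflections only see the symmetric part of `M`. A product of two also contains the term
`v ⬝ᵥ M *ᵥ u`, which detects asymmetry. -/
lemma trace_mul_householder_mul_householder (M : Matrix n n ℝ) (u v : n → ℝ) :
    (M * (householder u * householder v)).trace =
      M.trace - 2 / (u ⬝ᵥ u) * (u ⬝ᵥ M *ᵥ u) - 2 / (v ⬝ᵥ v) * (v ⬝ᵥ M *ᵥ v) +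
        2 / (u ⬝ᵥ u) * (2 / (v ⬝ᵥ v)) * (u ⬝ᵥ v) * (v ⬝ᵥ M *ᵥ u) := by
  rw [← mul_assoc, trace_mul_householder, trace_mul_householder]
  have : v ⬝ᵥ (M * householder u) *ᵥ v =
      v ⬝ᵥ M *ᵥ v - 2 / (u ⬝ᵥ u) * ((u ⬝ᵥ v) * (v ⬝ᵥ M *ᵥ u)) := by
    rw [← mulVec_mulVec, householder, sub_mulVec, one_mulVec, smul_mulVec, vecMulVec_mulVec]
    simp only [mulVec_sub, mulVec_smul, dotProduct_sub, dotProduct_smul, smul_eq_mul,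
      op_smul_eq_smul]
  rw [this]
  ring

/-- If the identity maximizes `V ↦ tr (M V)` over orthogonal matrices, then `M` is symmetric and
positive semidefinite. -/
lemma posSemidef_of_trace_mul_orthogonal_le (M : Matrix n n ℝ)
    (h : ∀ V ∈ orthogonalGroup n ℝ, (M * V).trace ≤ M.trace) : M.PosSemidef := by
  have hnn : ∀ u : n → ℝ, 0 ≤ u ⬝ᵥ M *ᵥ u := by
    intro u
    by_cases hu : u ⬝ᵥ u = 0
    · rw [dotProduct_self_eq_zero] at hu
      simp [hu]
    have h1 := h _ (householder_mem_orthogonalGroup hu)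
    rw [trace_mul_householder] at h1
    have hpos : 0 < u ⬝ᵥ u := lt_of_le_of_ne
      (Finset.sum_nonneg fun i _ => mul_self_nonneg _) (Ne.symm hu)
    have h2 : 0 ≤ 2 / (u ⬝ᵥ u) * (u ⬝ᵥ M *ᵥ u) := by linarith
    exact nonneg_of_mul_nonneg_right h2 (by positivity)
  have hsymm : ∀ i j, i ≠ j → M j i = M i j := by
    intro i j hij
    have hi := hnn (Pi.single i 1)
    have hj := hnn (Pi.single j 1)
    -- Reflecting in `e_i` and in `e_i + t e_j` will give `t * D ≤ t ^ 2 * s`, where `D = M j i - M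
    -- i j` and `s = M i i + M j j`. With `D = t * (s + 1)` this forces `t = 0`; the added `1` also
    -- keeps the denominator positive.
    set t : ℝ := (M j i - M i j) / (M i i + M j j + 1) with ht
    have huu : (Pi.single i 1 : n → ℝ) ⬝ᵥ Pi.single i 1 = 1 := by simp
    set w : n → ℝ := Pi.single i 1 + t • Pi.single j 1 with hw
    have hww : w ⬝ᵥ w = 1 + t ^ 2 := by
      simp [hw, hij, hij.symm]; ring
    have huw : (Pi.single i 1 : n → ℝ) ⬝ᵥ w = 1 := by simp [hw, hij]
    have hwMw : w ⬝ᵥ M *ᵥ w = M i i + t * (M j i + M i j) + t ^ 2 * M j j := by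
      simp [hw, mulVec_add, mulVec_smul]; ring
    have hwMu : w ⬝ᵥ M *ᵥ (Pi.single i 1 : n → ℝ) = M i i + t * M j i := by
      simp [hw]
    have hiM : (Pi.single i 1 : n → ℝ) ⬝ᵥ M *ᵥ (Pi.single i 1 : n → ℝ) = M i i := by simp
    have hjM : (Pi.single j 1 : n → ℝ) ⬝ᵥ M *ᵥ (Pi.single j 1 : n → ℝ) = M j j := by simp
    have hpos : 0 < 1 + t ^ 2 := by positivity
    have h1 := h _ (mul_mem (householder_mem_orthogonalGroup (by rw [huu]; exact one_ne_zero))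
      (householder_mem_orthogonalGroup (u := w) (by rw [hww]; exact hpos.ne')))
    rw [trace_mul_householder_mul_householder, huu, hww, huw, hwMw, hwMu, hiM] at h1
    rw [hiM] at hi
    rw [hjM] at hj
    have h2 : t * (M j i - M i j) ≤ t ^ 2 * (M i i + M j j) := by
      have h3 : (M.trace - 2 / 1 * M i i - 2 / (1 + t ^ 2) * (M i i + t * (M j i + M i j) +
          t ^ 2 * M j j) + 2 / 1 * (2 / (1 + t ^ 2)) * 1 * (M i i + t * M j i) - M.trace)
          = 2 / (1 + t ^ 2) * (t * (M j i - M i j) - t ^ 2 * (M i i + M j j)) := by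
        field_simp; ring
      have h4 : 2 / (1 + t ^ 2) * (t * (M j i - M i j) - t ^ 2 * (M i i + M j j)) ≤ 0 := by
        rw [← h3]; linarith
      have := nonpos_of_mul_nonpos_right h4 (by positivity)
      linarith
    have hs : 0 < M i i + M j j + 1 := by linarith
    have hD : M j i - M i j = t * (M i i + M j j + 1) := by rw [ht]; field_simp
    rw [hD] at h2
    have ht0 : t = 0 := by nlinarith [sq_nonneg t]
    rw [ht0, zero_mul] at hD
    linarith
  refine .of_dotProduct_mulVec_nonneg ?_ fun x => by simpa using hnn x
  ext i j
  by_cases hij : i = j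
  · simp [hij]
  · simpa using hsymm i j hij

/-- Square roots of the positive definite matrices `S j` can be chosen so that each of them is
optimally aligned with their weighted mean. -/
theorem exists_aligned_factors {ι : Type*} [Fintype ι] (lam : ι → ℝ)
    (S : ι → Matrix n n ℝ) (hS : ∀ j, (S j).PosDef) :
    ∃ Y : ι → Matrix n n ℝ, (∀ j, Y j * (Y j)ᵀ = S j) ∧
      ∀ j, 0 < lam j → ((∑ i, lam i • Y i)ᵀ * Y j).PosDef := by
  classical
  let C : Set (ι → Matrix n n ℝ) := {Y | ∀ j, Y j * (Y j)ᵀ = S j}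
  have hCne : C.Nonempty := by
    have : ∀ j, ∃ B : Matrix n n ℝ, B * Bᵀ = S j := fun j => by
      have hsymm : (CFC.sqrt (S j))ᵀ = CFC.sqrt (S j) := by
        simpa [star_eq_conjTranspose] using (CFC.sqrt_nonneg (S j)).isSelfAdjoint.star_eq
      exact ⟨CFC.sqrt (S j), by rw [hsymm, CFC.sqrt_mul_sqrt_self _ (hS j).posSemidef.nonneg]⟩
    choose B hB using this
    exact ⟨B, hB⟩
  have hCclosed : IsClosed C := by
    have : C = ⋂ j, {Y : ι → Matrix n n ℝ | Y j * (Y j)ᵀ = S j} := by ext; simp [C]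
    rw [this]
    exact isClosed_iInter fun j => isClosed_eq (by fun_prop) continuous_const
  have hCcompact : IsCompact C := by
    let K : Set (ι → n → n → ℝ) := Set.pi Set.univ fun j => Set.pi Set.univ fun a =>
      Set.pi Set.univ fun _ => Set.Icc (-(S j a a + 1)) (S j a a + 1)
    have hK : IsCompact K := isCompact_univ_pi fun j => isCompact_univ_pi fun a =>
      isCompact_univ_pi fun _ => isCompact_Icc
    refine IsCompact.of_isClosed_subset hK hCclosed ?_
    intro Y hY j _ a _ b _
    -- The diagonal of `S j` prescribes the row norms of `Y j`, so the entries are bounded.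
    have hjab : (Y j a b) ^ 2 ≤ S j a a := by
      rw [← hY j, mul_apply]
      simp only [transpose_apply, ← sq]
      exact Finset.single_le_sum (f := fun b => (Y j a b) ^ 2) (fun _ _ => sq_nonneg _)
        (Finset.mem_univ b)
    exact ⟨by nlinarith, by nlinarith⟩
  let F : (ι → Matrix n n ℝ) → ℝ := fun Y => ((∑ i, lam i • Y i)ᵀ * ∑ i, lam i • Y i).trace
  have hF : Continuous F := by
    refine Continuous.matrix_trace ?_
    fun_prop
  obtain ⟨Y, hY, hmax⟩ := hCcompact.exists_isMaxOn hCne hF.continuousOn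
  refine ⟨Y, hY, fun j hj => ?_⟩
  set A := ∑ i, lam i • Y i with hA
  set N := A - lam j • Y j with hN
  -- Replacing `Y j` by `Y j * V` with `V` orthogonal preserves the constraint and changes only the
  -- cross term with the other summands `N`. Restoring the own term `lam j • Y j` in `A` later
  -- upgrades semidefinite to definite.
  have hNps : (Nᵀ * Y j).PosSemidef := by
    refine posSemidef_of_trace_mul_orthogonal_le _ fun V hV => ?_
    have hVV : V * Vᵀ = 1 := (mem_orthogonalGroup_iff n ℝ).mp hV
    have hmem : Function.update Y j (Y j * V) ∈ C := by
      intro i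
      by_cases hi : i = j
      · subst hi
        rw [Function.update_self, transpose_mul, mul_assoc, ← mul_assoc V, hVV, one_mul]
        exact hY i
      · rw [Function.update_of_ne hi]; exact hY i
    have hle : F _ ≤ F Y := hmax hmem
    have hA' : ∑ i, lam i • Function.update Y j (Y j * V) i = N + lam j • (Y j * V) := by
      rw [hN, hA, ← Finset.add_sum_erase _ _ (Finset.mem_univ j),
        ← Finset.add_sum_erase (a := j) Finset.univ (fun i => lam i • Y i) (Finset.mem_univ j),
        Function.update_self, add_sub_cancel_left, add_comm]
      congr 1
      refine Finset.sum_congr rfl fun i hi => ?_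
      rw [Function.update_of_ne (Finset.ne_of_mem_erase hi)]
    have hA'' : ∑ i, lam i • Y i = N + lam j • Y j := by rw [hN, hA]; abel
    have hexp : ∀ Z : Matrix n n ℝ, ((N + lam j • Z)ᵀ * (N + lam j • Z)).trace =
        (Nᵀ * N).trace + 2 * lam j * (Nᵀ * Z).trace + lam j ^ 2 * (Z * Zᵀ).trace := by
      intro Z
      have h1 : (Zᵀ * N).trace = (Nᵀ * Z).trace := by
        rw [← trace_transpose, transpose_mul, transpose_transpose]
      simp only [transpose_add, transpose_smul, add_mul, mul_add, smul_mul_assoc, mul_smul_comm,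
        trace_add, trace_smul, smul_eq_mul, h1, trace_mul_comm Zᵀ Z]
      ring
    simp only [F] at hle
    rw [hA', hA'', hexp, hexp] at hle
    have hVY : (Y j * V) * (Y j * V)ᵀ = Y j * (Y j)ᵀ := by
      rw [transpose_mul, mul_assoc, ← mul_assoc V, hVV, one_mul]
    rw [hVY] at hle
    have : lam j * (Nᵀ * (Y j * V)).trace ≤ lam j * (Nᵀ * Y j).trace := by linarith
    rw [mul_assoc]
    exact le_of_mul_le_mul_left this hj
  have hYY : ((Y j)ᵀ * Y j).PosDef := by
    have hu : IsUnit (Y j) := by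
      rw [isUnit_iff_isUnit_det]
      have := (hS j).isUnit
      rw [← hY j, isUnit_iff_isUnit_det, det_mul] at this
      exact isUnit_of_mul_isUnit_left this
    have := PosDef.one (n := n) (R := ℝ) |>.conjTranspose_mul_mul_same
      (B := Y j) (mulVec_injective_iff_isUnit.mpr hu)
    simpa using this
  have hAe : Aᵀ * Y j = Nᵀ * Y j + lam j • ((Y j)ᵀ * Y j) := by
    rw [hN, transpose_sub, sub_mul, transpose_smul, smul_mul_assoc]; abel
  rw [hAe]
  exact PosDef.posSemidef_add hNps (hYY.smul hj)

end Procrustes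

/-! ### The Gaussian barycenter and its affine transport maps. -/

section GaussianTransport

open Matrix
open scoped RealInnerProductSpace MatrixOrder

variable {ι : Type*} [Fintype ι] [DecidableEq ι]

/-- Allowing an arbitrary factor `Y` in place of the symmetric root lets one standard Gaussian
vector drive all the measures at once through the aligned factors. -/
lemma stdGaussian_map_eq_multivariateGaussian (m : EuclideanSpace ℝ ι) (Y S : Matrix ι ι ℝ)
    (hY : Y * Yᵀ = S) :
    (stdGaussian (EuclideanSpace ℝ ι)).map (fun x => m + toEuclideanCLM (𝕜 := ℝ) Y x) =
      multivariateGaussian m S := by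
  have hS : S.PosSemidef := by
    rw [← hY]; simpa using posSemidef_self_mul_conjTranspose Y
  have h : (fun x ↦ m + (toEuclideanCLM (𝕜 := ℝ) Y) x) =
    (fun x ↦ m + x) ∘ ((toEuclideanCLM (𝕜 := ℝ) Y)) := rfl
  have hmap : (stdGaussian (EuclideanSpace ℝ ι)).map (fun x => m + toEuclideanCLM (𝕜 := ℝ) Y x) =
      ((stdGaussian (EuclideanSpace ℝ ι)).map (toEuclideanCLM (𝕜 := ℝ) Y)).map
        (fun x => m + x) := by
    rw [h, ← Measure.map_map (measurable_const_add m) (by fun_prop)]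
  have hG : IsGaussian
      ((stdGaussian (EuclideanSpace ℝ ι)).map (fun x => m + toEuclideanCLM (𝕜 := ℝ) Y x)) := by
    rw [hmap]; infer_instance
  apply IsGaussian.ext
  · simp only [id_eq, integral_id_multivariateGaussian]
    rw [integral_map (by fun_prop) (by fun_prop), integral_add (integrable_const _), integral_const]
    · simp [ContinuousLinearMap.integral_comp_comm _ IsGaussian.integrable_fun_id]
    · exact IsGaussian.integrable_id.comp_measurable (by fun_prop)
  · ext x y
    rw [covarianceBilin_multivariateGaussian hS, hmap, covarianceBilin_map_const_add,
      covarianceBilin_map IsGaussian.memLp_two_id, covarianceBilin_stdGaussian,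
      innerSL_apply_apply, ContinuousLinearMap.adjoint_inner_left,
      ← ContinuousLinearMap.star_eq_adjoint, ← map_star, ← ContinuousLinearMap.comp_apply,
      ← ContinuousLinearMap.mul_def, ← map_mul, star_eq_conjTranspose,
      conjTranspose_eq_transpose_of_trivial, hY, inner_toEuclideanCLM]

/-- The Gaussian barycenter `ν` of nondegenerate Gaussian measures, together with the affine maps
`z ↦ m j + T j (z - ∑ i, lam i • m i)` transporting `ν` to them. -/
lemma exists_gaussian_barycenter_maps {κ : Type*} [Fintype κ] (lam : κ → ℝ)
    (hlam : ∑ j, lam j = 1) (m : κ → EuclideanSpace ℝ ι)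
    (S : κ → Matrix ι ι ℝ) (hS : ∀ j, (S j).PosDef) :
    ∃ (ν : Measure (EuclideanSpace ℝ ι))
      (T B : κ → EuclideanSpace ℝ ι →L[ℝ] EuclideanSpace ℝ ι), IsGaussian ν ∧
      (∀ z, ∑ j, lam j • T j z = z) ∧
      (∀ j, ν.map (fun z => m j + T j (z - ∑ i, lam i • m i)) =
        multivariateGaussian (m j) (S j)) ∧
      ∀ j, 0 < lam j → ∀ x y, ⟪B j x, B j (T j y)⟫ = ⟪x, y⟫ := by
  classical
  obtain ⟨Y, hYS, hpd⟩ := exists_aligned_factors lam S hS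
  set A := ∑ i, lam i • Y i with hA
  obtain ⟨j₀, hj₀⟩ : ∃ j, 0 < lam j := by
    by_contra! h
    have : ∑ j, lam j ≤ 0 := Finset.sum_nonpos fun j _ => h j
    linarith
  have hAunit : IsUnit A := by
    have := (hpd j₀ hj₀).isUnit
    rw [isUnit_iff_isUnit_det, det_mul, det_transpose] at this
    exact (isUnit_iff_isUnit_det _).mpr (isUnit_of_mul_isUnit_left this)
  have hdet : IsUnit A.det := (isUnit_iff_isUnit_det _).mp hAunit
  have hAinv : A⁻¹ * A = 1 := nonsing_inv_mul _ hdet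
  have hAinv' : A * A⁻¹ = 1 := mul_nonsing_inv _ hdet
  -- `Y j * A⁻¹` is the congruence of `Aᵀ * Y j` by `A⁻¹`, so alignment turns it into a symmetric
  -- positive definite transport map.
  have hTpd : ∀ j, 0 < lam j → (Y j * A⁻¹).PosDef := by
    intro j hj
    have h1 := (hpd j hj).conjTranspose_mul_mul_same (B := A⁻¹)
      (mulVec_injective_iff_isUnit.mpr (isUnit_nonsing_inv_iff.mpr hAunit))
    have h2 : (A⁻¹)ᴴ * (Aᵀ * Y j) * A⁻¹ = Y j * A⁻¹ := by
      rw [conjTranspose_eq_transpose_of_trivial, ← mul_assoc, ← transpose_mul, hAinv',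
        transpose_one, one_mul]
    rwa [h2] at h1
  let R : κ → Matrix ι ι ℝ := fun j => CFC.sqrt (Y j * A⁻¹)⁻¹
  let mb := ∑ i, lam i • m i
  refine ⟨(stdGaussian (EuclideanSpace ℝ ι)).map (fun x => mb + toEuclideanCLM (𝕜 := ℝ) A x),
    fun j => toEuclideanCLM (𝕜 := ℝ) (Y j * A⁻¹), fun j => toEuclideanCLM (𝕜 := ℝ) (R j), ?_, ?_,
    ?_, ?_⟩
  · rw [stdGaussian_map_eq_multivariateGaussian mb A _ rfl]
    infer_instance
  · intro z
    have : ∑ j, lam j • toEuclideanCLM (n := ι) (𝕜 := ℝ) (Y j * A⁻¹) =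
        1 := by
      simp_rw [← map_smul, ← map_sum, ← smul_mul_assoc, ← Finset.sum_mul]
      rw [← hA, hAinv', map_one]
    have h2 := congrArg (fun f => f z) this
    simpa using h2
  · intro j
    rw [Measure.map_map (by fun_prop) (by fun_prop),
      ← stdGaussian_map_eq_multivariateGaussian (m j) (Y j) (S j) (hYS j)]
    congr 1
    funext x
    simp only [Function.comp, mb, add_sub_cancel_left]
    rw [← ContinuousLinearMap.comp_apply, ← ContinuousLinearMap.mul_def, ← map_mul, mul_assoc,
      hAinv, mul_one]
  · intro j hj x y
    have hinv := (hTpd j hj).inv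
    have hsa : star (R j) = R j := (CFC.sqrt_nonneg _).isSelfAdjoint.star_eq
    have hunit := (isUnit_iff_isUnit_det _).mp (hTpd j hj).isUnit
    have hRR : R j * R j * (Y j * A⁻¹) = 1 := by
      rw [CFC.sqrt_mul_sqrt_self _ hinv.posSemidef.nonneg, nonsing_inv_mul _ hunit]
    rw [← ContinuousLinearMap.adjoint_inner_right, ← ContinuousLinearMap.star_eq_adjoint,
      ← map_star, hsa, ← ContinuousLinearMap.comp_apply, ← ContinuousLinearMap.comp_apply,
      ← ContinuousLinearMap.mul_def, ← ContinuousLinearMap.mul_def, ← map_mul, ← map_mul,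
      hRR, map_one]
    rfl

end GaussianTransport

/-! ### Square-integrable functions. -/

section SecondMoments

open scoped RealInnerProductSpace

lemma MeasureTheory.MemLp.integrable_sq_norm {α E : Type*} {_ : MeasurableSpace α} {μ : Measure α}
    [NormedAddCommGroup E] {f : α → E} (hf : MemLp f 2 μ) : Integrable (fun x => ‖f x‖ ^ 2) μ :=
  (memLp_two_iff_integrable_sq_norm hf.1).mp hf

lemma MeasureTheory.MemLp.integrable_real_inner {α E : Type*} {_ : MeasurableSpace α}
    {μ : Measure α} [NormedAddCommGroup E] [InnerProductSpace ℝ E] {f g : α → E}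
    (hf : MemLp f 2 μ) (hg : MemLp g 2 μ) : Integrable (fun x => ⟪f x, g x⟫) μ := by
  have h := ((hf.add hg).integrable_sq_norm.sub (hf.sub hg).integrable_sq_norm).div_const 4
  refine h.congr (Filter.Eventually.of_forall fun x => ?_)
  simp only [Pi.add_apply, Pi.sub_apply, norm_add_sq_real, norm_sub_sq_real]
  ring

lemma lintegral_enorm_sq_eq_ofReal {α E : Type*} {_ : MeasurableSpace α} {μ : Measure α}
    [NormedAddCommGroup E] {f : α → E} (hf : MemLp f 2 μ) :
    ∫⁻ x, ‖f x‖ₑ ^ 2 ∂μ = ENNReal.ofReal (∫ x, ‖f x‖ ^ 2 ∂μ) := by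
  rw [ofReal_integral_eq_lintegral_ofReal hf.integrable_sq_norm
    (Filter.Eventually.of_forall fun x => by positivity)]
  refine lintegral_congr fun x => ?_
  rw [ENNReal.ofReal_pow (norm_nonneg _), ofReal_norm]

end SecondMoments

/-! ### Finiteness of `W₂²` and separation of measures. -/

namespace GMMOT

open scoped RealInnerProductSpace

variable {d J : ℕ}

lemma memLp_two_id_of_mem_P2 {ρ : Measure (Rd d)} (h : ρ ∈ P2 d) : MemLp id 2 ρ := by
  rw [memLp_two_iff_integrable_sq_norm (by fun_prop)]
  refine ⟨by fun_prop, ?_⟩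
  rw [hasFiniteIntegral_iff_enorm]
  simpa [enorm_pow] using h.2

lemma mem_P2_of_isGaussian (ρ : Measure (Rd d)) [IsGaussian ρ] : ρ ∈ P2 d := by
  refine ⟨inferInstance, ?_⟩
  have := lintegral_enorm_sq_eq_ofReal (IsGaussian.memLp_two_id (μ := ρ))
  simp only [id_eq] at this
  rw [this]
  exact ENNReal.ofReal_lt_top

lemma memLp_fst_of_mem_couplings {μ ρ : Measure (Rd d)} {γ : Measure (Rd d × Rd d)}
    (hγ : γ ∈ couplings μ ρ) (h : MemLp id 2 μ) : MemLp (fun y : Rd d × Rd d => y.1) 2 γ := by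
  rw [← hγ.2.1] at h
  exact (memLp_map_measure_iff (f := Prod.fst) (g := id) (by fun_prop) (by fun_prop)).mp h

lemma memLp_snd_of_mem_couplings {μ ρ : Measure (Rd d)} {γ : Measure (Rd d × Rd d)}
    (hγ : γ ∈ couplings μ ρ) (h : MemLp id 2 ρ) : MemLp (fun y : Rd d × Rd d => y.2) 2 γ := by
  rw [← hγ.2.2] at h
  exact (memLp_map_measure_iff (f := Prod.snd) (g := id) (by fun_prop) (by fun_prop)).mp h

lemma prod_mem_couplings (μ ρ : Measure (Rd d)) [IsProbabilityMeasure μ]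
    [IsProbabilityMeasure ρ] : μ.prod ρ ∈ couplings μ ρ :=
  ⟨inferInstance, by simp, by simp⟩

lemma W2sq_ne_top {μ ρ : Measure (Rd d)} (hμ : μ ∈ P2 d) (hρ : ρ ∈ P2 d) : W2sq μ ρ ≠ ∞ := by
  have := hμ.1
  have := hρ.1
  have hc := prod_mem_couplings μ ρ
  refine ne_top_of_le_ne_top ?_ (iInf₂_le _ hc)
  have := lintegral_enorm_sq_eq_ofReal
    ((memLp_fst_of_mem_couplings hc (memLp_two_id_of_mem_P2 hμ)).sub
      (memLp_snd_of_mem_couplings hc (memLp_two_id_of_mem_P2 hρ)))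
  simp only [Pi.sub_apply] at this
  rw [this]
  exact ENNReal.ofReal_ne_top

/-- `W₂` separates probability measures. -/
lemma eq_of_W2sq_eq_zero {μ ρ : Measure (Rd d)} [IsProbabilityMeasure μ] [IsProbabilityMeasure ρ]
    (h : W2sq μ ρ = 0) : μ = ρ := by
  refine Measure.ext_of_charFun ?_
  funext t
  rw [← sub_eq_zero, ← norm_le_zero_iff]
  refine le_of_forall_pos_le_add fun ε hε => ?_
  rw [zero_add]
  -- Chosen so that `‖t‖ * δ ≤ ε`. A plan of cost below `δ ^ 2` suffices, so no optimal plan is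
  -- needed.
  set δ : ℝ := ε / (‖t‖ + 1) with hδ
  have hδpos : 0 < δ := by positivity
  obtain ⟨γ, hγ, hlt⟩ : ∃ γ ∈ couplings μ ρ,
      ∫⁻ y, ‖y.1 - y.2‖ₑ ^ 2 ∂γ < ENNReal.ofReal (δ ^ 2) := by
    have : W2sq μ ρ < ENNReal.ofReal (δ ^ 2) := by rw [h]; simpa using by positivity
    simpa [W2sq, iInf_lt_iff] using this
  have := hγ.1
  have hint : Integrable (fun y : Rd d × Rd d => ‖y.1 - y.2‖ ^ 2) γ := by
    refine ⟨by fun_prop, ?_⟩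
    rw [hasFiniteIntegral_iff_enorm]
    simpa [enorm_pow] using hlt.trans ENNReal.ofReal_lt_top
  have hmem : MemLp (fun y : Rd d × Rd d => y.1 - y.2) 2 γ :=
    (memLp_two_iff_integrable_sq_norm (by fun_prop)).mpr hint
  have hlt' : ∫ y, ‖y.1 - y.2‖ ^ 2 ∂γ < δ ^ 2 := by
    rw [lintegral_enorm_sq_eq_ofReal hmem] at hlt
    exact (ENNReal.ofReal_lt_ofReal_iff (by positivity)).mp hlt
  have hb : ∀ f : Rd d × Rd d → Rd d, Measurable f →
      Integrable (fun y => Complex.exp (⟪f y, t⟫ * Complex.I)) γ := fun f hf =>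
    Integrable.of_bound (by fun_prop) 1
      (Filter.Eventually.of_forall fun y => by rw [Complex.norm_exp_ofReal_mul_I])
  rw [charFun_apply, charFun_apply, ← hγ.2.1, ← hγ.2.2,
    integral_map (by fun_prop) (by fun_prop), integral_map (by fun_prop) (by fun_prop),
    ← integral_sub (hb _ measurable_fst) (hb _ measurable_snd)]
  have hpt : ∀ y : Rd d × Rd d,
      ‖Complex.exp (⟪y.1, t⟫ * Complex.I) - Complex.exp (⟪y.2, t⟫ * Complex.I)‖ ≤
        ‖t‖ * ((δ + δ⁻¹ * ‖y.1 - y.2‖ ^ 2) / 2) := by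
    intro y
    have h1 : Complex.exp (⟪y.1, t⟫ * Complex.I) - Complex.exp (⟪y.2, t⟫ * Complex.I) =
        Complex.exp (⟪y.2, t⟫ * Complex.I) *
          (Complex.exp (Complex.I * ((⟪y.1 - y.2, t⟫ : ℝ) : ℂ)) - 1) := by
      rw [mul_sub, mul_one, ← Complex.exp_add, inner_sub_left]
      push_cast
      ring_nf
    rw [h1, norm_mul, Complex.norm_exp_ofReal_mul_I, one_mul]
    refine Real.norm_exp_I_mul_ofReal_sub_one_le.trans ?_
    refine (norm_inner_le_norm _ _).trans ?_
    rw [mul_comm]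
    refine mul_le_mul_of_nonneg_left ?_ (norm_nonneg _)
    -- Weighted AM-GM bounds the distance by its square, the quantity controlled by the plan.
    have h2 : 0 ≤ δ⁻¹ * (δ - ‖y.1 - y.2‖) ^ 2 := by positivity
    have h3 : δ⁻¹ * (δ - ‖y.1 - y.2‖) ^ 2 =
        δ - 2 * ‖y.1 - y.2‖ + δ⁻¹ * ‖y.1 - y.2‖ ^ 2 := by field_simp; ring
    linarith
  have hle := norm_integral_le_of_norm_le
    ((((integrable_const δ).add (hint.const_mul δ⁻¹)).div_const 2).const_mul ‖t‖)
    (Filter.Eventually.of_forall hpt)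
  refine hle.trans ?_
  simp only [Pi.add_apply]
  rw [integral_const_mul, integral_div, integral_add (integrable_const δ) (hint.const_mul δ⁻¹),
    integral_const, integral_const_mul]
  have h4 : δ⁻¹ * ∫ y, ‖y.1 - y.2‖ ^ 2 ∂γ ≤ δ := by
    rw [inv_mul_le_iff₀ hδpos]; nlinarith
  have h5 : ‖t‖ * δ ≤ ε := by
    rw [hδ, mul_div_assoc', div_le_iff₀ (by positivity)]; nlinarith [norm_nonneg t]
  simp only [probReal_univ, one_smul]
  calc _ ≤ ‖t‖ * δ := by gcongr; linarith
    _ ≤ ε := h5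

end GMMOT

/-! ### Quadratic Kantorovich potentials and the duality gap. -/

namespace GMMOT

open scoped RealInnerProductSpace

variable {d J : ℕ}

/-- Kantorovich potential on the side of the given Gaussian measure, with mean `m`. -/
noncomputable def fstPotential (m mb : Rd d) (B : Rd d →L[ℝ] Rd d) (x : Rd d) : ℝ :=
  ‖x - m‖ ^ 2 - ‖B (x - m)‖ ^ 2 + 2 * ⟪x - m, m - mb⟫ + ‖m - mb‖ ^ 2

/-- Kantorovich potential on the side of the barycenter, with mean `mb`. -/
noncomputable def sndPotential (m mb : Rd d) (T : Rd d →L[ℝ] Rd d) (y : Rd d) : ℝ :=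
  ‖y - mb‖ ^ 2 - ⟪y - mb, T (y - mb)⟫ - 2 * ⟪y - mb, m - mb⟫

/-- The hypothesis says that `B* B T` is the identity. Completing the square in the metric `B* B`
leaves a gap that vanishes on the graph of the transport map. -/
lemma sq_norm_sub_eq_potentials (m mb : Rd d) {T B : Rd d →L[ℝ] Rd d}
    (hB : ∀ x y, ⟪B x, B (T y)⟫ = ⟪x, y⟫) (x y : Rd d) :
    ‖x - y‖ ^ 2 = fstPotential m mb B x + sndPotential m mb T y +
      ‖B (x - (m + T (y - mb)))‖ ^ 2 := by
  unfold fstPotential sndPotential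
  have h1 : x - y = (x - m) - (y - mb) + (m - mb) := by abel
  have h2 : x - (m + T (y - mb)) = (x - m) - T (y - mb) := by abel
  rw [h1, h2]
  generalize x - m = u
  generalize y - mb = v
  generalize m - mb = e
  have h3 : ‖B (T v)‖ ^ 2 = ⟪v, T v⟫ := by
    rw [← real_inner_self_eq_norm_sq, hB, real_inner_comm]
  rw [map_sub, norm_add_sq_real, norm_sub_sq_real, norm_sub_sq_real, hB, h3, inner_sub_left]
  ring

lemma integrable_fstPotential {ρ : Measure (Rd d)} [IsFiniteMeasure ρ] (hρ : MemLp id 2 ρ)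
    (m mb : Rd d) (B : Rd d →L[ℝ] Rd d) : Integrable (fstPotential m mb B) ρ := by
  have h1 : MemLp (fun x => x - m) 2 ρ := hρ.sub (memLp_const m)
  have h2 : MemLp (fun x => B (x - m)) 2 ρ := B.comp_memLp' h1
  exact ((h1.integrable_sq_norm.sub h2.integrable_sq_norm).add
    ((h1.integrable_real_inner (memLp_const _)).const_mul 2)).add (integrable_const _)

lemma integrable_sndPotential {ρ : Measure (Rd d)} [IsFiniteMeasure ρ] (hρ : MemLp id 2 ρ)
    (m mb : Rd d) (T : Rd d →L[ℝ] Rd d) : Integrable (sndPotential m mb T) ρ := by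
  have h1 : MemLp (fun x => x - mb) 2 ρ := hρ.sub (memLp_const mb)
  have h2 : MemLp (fun x => T (x - mb)) 2 ρ := T.comp_memLp' h1
  exact (h1.integrable_sq_norm.sub (h1.integrable_real_inner h2)).sub
    ((h1.integrable_real_inner (memLp_const _)).const_mul 2)

/-- The potential terms depend on the marginals alone, so plans with the same marginals differ in
cost only through the gap. -/
lemma lintegral_cost_eq_potentials (m mb : Rd d) {T B : Rd d →L[ℝ] Rd d}
    (hB : ∀ x y, ⟪B x, B (T y)⟫ = ⟪x, y⟫) {G ρ : Measure (Rd d)} (hG : MemLp id 2 G)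
    (hρ : MemLp id 2 ρ) {γ : Measure (Rd d × Rd d)} (hγ : γ ∈ couplings G ρ) :
    MemLp (fun y : Rd d × Rd d => B (y.1 - (m + T (y.2 - mb)))) 2 γ ∧
    ∫⁻ y, ‖y.1 - y.2‖ₑ ^ 2 ∂γ = ENNReal.ofReal (∫ x, fstPotential m mb B x ∂G +
      ∫ y, sndPotential m mb T y ∂ρ + ∫ y, ‖B (y.1 - (m + T (y.2 - mb)))‖ ^ 2 ∂γ) := by
  have := hγ.1
  have h1 := memLp_fst_of_mem_couplings hγ hG
  have h2 := memLp_snd_of_mem_couplings hγ hρ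
  have hgap : MemLp (fun y : Rd d × Rd d => B (y.1 - (m + T (y.2 - mb)))) 2 γ :=
    B.comp_memLp' (h1.sub ((memLp_const m).add (T.comp_memLp' (h2.sub (memLp_const mb)))))
  refine ⟨hgap, ?_⟩
  have hsub := lintegral_enorm_sq_eq_ofReal (h1.sub h2)
  simp only [Pi.sub_apply] at hsub
  rw [hsub]
  congr 1
  simp_rw [sq_norm_sub_eq_potentials m mb hB]
  have p1 : MeasurePreserving Prod.fst γ G := ⟨measurable_fst, hγ.2.1⟩
  have p2 : MeasurePreserving Prod.snd γ ρ := ⟨measurable_snd, hγ.2.2⟩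
  have : IsFiniteMeasure G := by rw [← hγ.2.1]; infer_instance
  have : IsFiniteMeasure ρ := by rw [← hγ.2.2]; infer_instance
  have j1 := integrable_fstPotential hG m mb B
  have j2 := integrable_sndPotential hρ m mb T
  have i1 : Integrable (fun y : Rd d × Rd d => fstPotential m mb B y.1) γ :=
    p1.integrable_comp_of_integrable j1
  have i2 : Integrable (fun y : Rd d × Rd d => sndPotential m mb T y.2) γ :=
    p2.integrable_comp_of_integrable j2
  have e1 : ∫ y, fstPotential m mb B y.1 ∂γ = ∫ x, fstPotential m mb B x ∂G := by
    have h := j1.1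
    rw [← p1.map_eq] at h ⊢
    exact (integral_map (by fun_prop) h).symm
  have e2 : ∫ y, sndPotential m mb T y.2 ∂γ = ∫ x, sndPotential m mb T x ∂ρ := by
    have h := j2.1
    rw [← p2.map_eq] at h ⊢
    exact (integral_map (by fun_prop) h).symm
  have h3 := integral_add (i1.add i2) hgap.integrable_sq_norm
  simp only [Pi.add_apply] at h3
  rw [h3, integral_add i1 i2, e1, e2]

lemma map_mem_couplings {μ ρ : Measure (Rd d)} {γ : Measure (Rd d × Rd d)}
    (hγ : γ ∈ couplings μ ρ) {f h : Rd d → Rd d} (hf : Measurable f) (hh : Measurable h) :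
    γ.map (Prod.map f h) ∈ couplings (μ.map f) (ρ.map h) := by
  have := hγ.1
  refine ⟨Measure.isProbabilityMeasure_map (by fun_prop), ?_, ?_⟩
  · rw [← hγ.2.1, Measure.map_map (by fun_prop) (by fun_prop),
      Measure.map_map (by fun_prop) (by fun_prop)]
    rfl
  · rw [← hγ.2.2, Measure.map_map (by fun_prop) (by fun_prop),
      Measure.map_map (by fun_prop) (by fun_prop)]
    rfl

/-- Duality bound for `W₂²`, with the duality gap estimated from below. -/
lemma potentials_add_W2sq_le (m mb : Rd d) {T B : Rd d →L[ℝ] Rd d}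
    (hB : ∀ x y, ⟪B x, B (T y)⟫ = ⟪x, y⟫) {G ρ : Measure (Rd d)} (hG : G ∈ P2 d)
    (hρ : ρ ∈ P2 d) :
    ∫ x, fstPotential m mb B x ∂G + ∫ y, sndPotential m mb T y ∂ρ +
      (W2sq (G.map B) (ρ.map (fun y => B (m + T (y - mb))))).toReal ≤ (W2sq G ρ).toReal := by
  rw [← ENNReal.ofReal_le_iff_le_toReal (W2sq_ne_top hG hρ)]
  refine le_iInf₂ fun γ hγ => ?_
  obtain ⟨hgap, hcost⟩ := lintegral_cost_eq_potentials m mb hB (memLp_two_id_of_mem_P2 hG)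
    (memLp_two_id_of_mem_P2 hρ) hγ
  rw [hcost]
  refine ENNReal.ofReal_le_ofReal ?_
  gcongr
  -- The gap is the cost of the image of `γ` under `B` and `B ∘ a`, where `a` is the affine
  -- transport map. Its lower bound by `W2sq` of the image marginals does not depend on `γ`, hence
  -- survives the infimum.
  refine ENNReal.toReal_le_of_le_ofReal (integral_nonneg fun _ => by positivity) ?_
  refine (iInf₂_le _ (map_mem_couplings hγ (f := B) (h := fun y => B (m + T (y - mb)))
    (by fun_prop) (by fun_prop))).trans ?_
  rw [lintegral_map (by fun_prop) (by fun_prop), ← lintegral_enorm_sq_eq_ofReal hgap]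
  simp only [Prod.map_fst, Prod.map_snd, map_sub, le_refl]

/-- The variance identity: pairwise distances can be replaced by distances to the weighted mean,
linking the multi-marginal cost to barycenters. -/
lemma half_sum_sum_sq_norm_sub {κ E : Type*} [Fintype κ] [NormedAddCommGroup E]
    [InnerProductSpace ℝ E] (lam : κ → ℝ) (hlam : ∑ j, lam j = 1) (y : κ → E) :
    1 / 2 * ∑ i, ∑ j, lam i * lam j * ‖y i - y j‖ ^ 2 =
      ∑ j, lam j * ‖y j - ∑ i, lam i • y i‖ ^ 2 := by
  have h1 : ∀ i, ∑ j, lam i * lam j * ‖y i - y j‖ ^ 2 =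
      lam i * ‖y i‖ ^ 2 - 2 * (lam i * ⟪y i, ∑ j, lam j • y j⟫) +
        lam i * ∑ j, lam j * ‖y j‖ ^ 2 := by
    intro i
    have : ∀ j, lam i * lam j * ‖y i - y j‖ ^ 2 = lam j * (lam i * ‖y i‖ ^ 2) -
        2 * (lam i * (lam j * ⟪y i, y j⟫)) + lam i * (lam j * ‖y j‖ ^ 2) := fun j => by
      rw [norm_sub_sq_real]; ring
    simp_rw [this, Finset.sum_add_distrib, Finset.sum_sub_distrib, ← Finset.sum_mul, hlam,
      ← Finset.mul_sum, inner_sum, real_inner_smul_right, one_mul]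
  have h2 : ∀ j, lam j * ‖y j - ∑ i, lam i • y i‖ ^ 2 = lam j * ‖y j‖ ^ 2 -
      2 * (lam j * ⟪y j, ∑ i, lam i • y i⟫) + lam j * ‖∑ i, lam i • y i‖ ^ 2 := fun j => by
    rw [norm_sub_sq_real]; ring
  have h3 : ∑ j, lam j * ⟪y j, ∑ i, lam i • y i⟫ = ‖∑ i, lam i • y i‖ ^ 2 := by
    rw [← real_inner_self_eq_norm_sq, sum_inner]
    simp_rw [real_inner_smul_left]
  simp_rw [h1, h2, Finset.sum_add_distrib, Finset.sum_sub_distrib, ← Finset.mul_sum,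
    ← Finset.sum_mul, hlam, h3]
  ring

lemma multiCost_eq_ofReal (lam : Fin J → ℝ≥0) (hlam : ∑ j, lam j = 1) (y : Fin J → Rd d) :
    (1 / 2 : ℝ≥0∞) * ∑ i, ∑ j, (lam i : ℝ≥0∞) * (lam j : ℝ≥0∞) * ‖y i - y j‖ₑ ^ 2 =
      ENNReal.ofReal (∑ j, (lam j : ℝ) * ‖y j - ∑ i, (lam i : ℝ) • y i‖ ^ 2) := by
  have hlam' : ∑ j, (lam j : ℝ) = 1 := by exact_mod_cast hlam
  rw [← half_sum_sum_sq_norm_sub _ hlam', ENNReal.ofReal_mul (by positivity),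
    ENNReal.ofReal_sum_of_nonneg fun i _ => Finset.sum_nonneg fun j _ => by positivity]
  congr 1
  · simp
  refine Finset.sum_congr rfl fun i _ => ?_
  rw [ENNReal.ofReal_sum_of_nonneg fun j _ => by positivity]
  refine Finset.sum_congr rfl fun j _ => ?_
  rw [ENNReal.ofReal_mul (by positivity), ENNReal.ofReal_mul (by positivity),
    ENNReal.ofReal_pow (norm_nonneg _), ofReal_norm, ENNReal.ofReal_coe_nnreal,
    ENNReal.ofReal_coe_nnreal]

end GMMOT

/-! ### Existence, optimality and uniqueness of the Gaussian barycenter. -/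

namespace GMMOT

open scoped RealInnerProductSpace

variable {d J : ℕ}

/-- This is dual feasibility: the quadratic terms cancel because the `T j` average to the identity,
the linear ones because the means average to `mb`. The unknown barycenter then drops out of the dual
bound. -/
lemma sum_mul_sndPotential_eq_zero {lam : Fin J → ℝ} (hlam : ∑ j, lam j = 1)
    {T : Fin J → Rd d →L[ℝ] Rd d} (hT : ∀ z, ∑ j, lam j • T j z = z) (m : Fin J → Rd d)
    (y : Rd d) : ∑ j, lam j * sndPotential (m j) (∑ i, lam i • m i) (T j) y = 0 := by
  unfold sndPotential
  set mb := ∑ i, lam i • m i with hmb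
  have h1 : ∑ j, lam j • (m j - mb) = 0 := by
    simp_rw [smul_sub, Finset.sum_sub_distrib, ← Finset.sum_smul, hlam, one_smul, ← hmb, sub_self]
  have h2 : ∀ j, lam j * (‖y - mb‖ ^ 2 - ⟪y - mb, T j (y - mb)⟫ - 2 * ⟪y - mb, m j - mb⟫) =
      lam j * ‖y - mb‖ ^ 2 - ⟪y - mb, lam j • T j (y - mb)⟫ -
        2 * ⟪y - mb, lam j • (m j - mb)⟫ := fun j => by
    rw [real_inner_smul_right, real_inner_smul_right]; ring
  simp_rw [h2, Finset.sum_sub_distrib, ← Finset.mul_sum, ← inner_sum, ← Finset.sum_mul, hlam, h1,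
    hT]
  simp

/-- Nondegenerate Gaussian measures have a unique `W₂` barycenter `ν`, which is Gaussian; it is
reached by Gaussian plans, and its cost is the multi-marginal cost. -/
theorem exists_gaussian_W2Barycenter (lam : Fin J → ℝ≥0) (hlam : ∑ j, lam j = 1)
    (m : Fin J → Rd d) (S : Fin J → Matrix (Fin d) (Fin d) ℝ) (hS : ∀ j, (S j).PosDef)
    (g : Fin J → Measure (Rd d)) (hg : ∀ j, g j = multivariateGaussian (m j) (S j)) :
    ∃ ν : Measure (Rd d), IsGaussian ν ∧ mmW2sq lam g ≠ ∞ ∧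
      (∀ ρ ∈ P2 d, mmW2sq lam g ≤ ∑ j, (lam j : ℝ≥0∞) * W2sq (g j) ρ) ∧
      (∀ ρ ∈ P2 d, ∑ j, (lam j : ℝ≥0∞) * W2sq (g j) ρ ≤ mmW2sq lam g → ρ = ν) ∧
      ∃ γ : Fin J → Measure (Rd d × Rd d), (∀ j, γ j ∈ couplings (g j) ν ∧ IsGaussian (γ j)) ∧
        ∑ j, (lam j : ℝ≥0∞) * ∫⁻ y, ‖y.1 - y.2‖ₑ ^ 2 ∂(γ j) = mmW2sq lam g := by
  have hlam' : ∑ j, (lam j : ℝ) = 1 := by exact_mod_cast hlam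
  obtain ⟨ν, T, B, hν, hT, hmap, hB⟩ :=
    exists_gaussian_barycenter_maps (fun j => (lam j : ℝ)) hlam' m S hS
  simp_rw [← hg] at hmap
  set mb := ∑ i, (lam i : ℝ) • m i with hmb
  set a : Fin J → Rd d → Rd d := fun j z => m j + T j (z - mb) with ha
  have ham : ∀ j, Measurable (a j) := fun j => by simp only [ha]; fun_prop
  have hgG : ∀ j, IsGaussian (g j) := fun j => by rw [hg]; infer_instance
  have hgP2 : ∀ j, g j ∈ P2 d := fun j => mem_P2_of_isGaussian _
  have hνP2 : ν ∈ P2 d := mem_P2_of_isGaussian _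
  set V : ℝ := ∑ j, (lam j : ℝ) * ∫ x, fstPotential (m j) mb (B j) x ∂(g j) with hV
  have hpsi : ∀ y, ∑ j, (lam j : ℝ) * sndPotential (m j) mb (T j) y = 0 :=
    sum_mul_sndPotential_eq_zero hlam' hT m
  have hpsi_int : ∀ ρ ∈ P2 d,
      ∑ j, (lam j : ℝ) * ∫ y, sndPotential (m j) mb (T j) y ∂ρ = 0 := by
    intro ρ hρ
    have := hρ.1
    simp_rw [← integral_const_mul]
    rw [← integral_finsetSum _ fun j _ => (integrable_sndPotential (memLp_two_id_of_mem_P2 hρ)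
      (m j) mb (T j)).const_mul _]
    simp_rw [hpsi, integral_zero]
  -- the transport plans
  set γ : Fin J → Measure (Rd d × Rd d) := fun j => ν.map (fun z => (a j z, z)) with hγ
  have hγc : ∀ j, γ j ∈ couplings (g j) ν := by
    intro j
    have := ham j
    refine ⟨Measure.isProbabilityMeasure_map (by fun_prop), ?_, ?_⟩
    · rw [← hmap j, hγ, Measure.map_map (by fun_prop) (by fun_prop)]; rfl
    · rw [hγ, Measure.map_map (by fun_prop) (by fun_prop)]
      exact Measure.map_id
  have hγG : ∀ j, IsGaussian (γ j) := by
    intro j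
    have h1 : (fun z => (a j z, z)) = (fun q : Rd d × Rd d => q + (m j - T j mb, 0)) ∘
        ((T j).prod (ContinuousLinearMap.id ℝ (Rd d))) := by
      funext z
      simp [ha]
      abel
    rw [hγ]
    simp only [h1]
    rw [← Measure.map_map (by fun_prop) (by fun_prop)]
    infer_instance
  have haL : ∀ j, MemLp (fun z => a j z - z) 2 ν := fun j => by
    have h : MemLp (fun z : Rd d => z - mb) 2 ν :=
      (memLp_two_id_of_mem_P2 hνP2).sub (memLp_const mb)
    exact ((memLp_const (m j)).add ((T j).comp_memLp' h)).sub (memLp_two_id_of_mem_P2 hνP2)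
  have hcost : ∀ j, ∫⁻ y, ‖y.1 - y.2‖ₑ ^ 2 ∂(γ j) =
      ENNReal.ofReal (∫ z, ‖a j z - z‖ ^ 2 ∂ν) := by
    intro j
    have := ham j
    rw [hγ, lintegral_map (by fun_prop) (by fun_prop), ← lintegral_enorm_sq_eq_ofReal (haL j)]
  have hcostV : ∑ j, (lam j : ℝ) * ∫ z, ‖a j z - z‖ ^ 2 ∂ν = V := by
    have h1 : ∀ j, (lam j : ℝ) * ∫ z, ‖a j z - z‖ ^ 2 ∂ν =
        (lam j : ℝ) * ∫ x, fstPotential (m j) mb (B j) x ∂(g j) +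
          (lam j : ℝ) * ∫ y, sndPotential (m j) mb (T j) y ∂ν := by
      intro j
      -- The identity for `B j` is available only at positive weight; at weight zero both sides
      -- vanish.
      rcases eq_or_lt_of_le (lam j).coe_nonneg with h0 | h0
      · simp [← h0]
      rw [← mul_add]
      congr 1
      have i1 := integrable_fstPotential (memLp_two_id_of_mem_P2 (hgP2 j)) (m j) mb (B j)
      have p1 : MeasurePreserving (a j) ν (g j) := ⟨ham j, hmap j⟩
      have e1 : ∫ x, fstPotential (m j) mb (B j) x ∂(g j) =
          ∫ z, fstPotential (m j) mb (B j) (a j z) ∂ν := by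
        have h := i1.1
        rw [← p1.map_eq] at h ⊢
        exact integral_map (ham j).aemeasurable h
      have i1' : Integrable (fun z => fstPotential (m j) mb (B j) (a j z)) ν :=
        p1.integrable_comp_of_integrable i1
      rw [e1, ← integral_add i1'
        (integrable_sndPotential (memLp_two_id_of_mem_P2 hνP2) (m j) mb (T j))]
      refine integral_congr_ae (Filter.Eventually.of_forall fun z => ?_)
      simp only
      rw [sq_norm_sub_eq_potentials (m j) mb (hB j h0)]
      simp [ha]
    simp_rw [h1, Finset.sum_add_distrib, hpsi_int ν hνP2, add_zero]
    rfl
  have hγcost : ∑ j, (lam j : ℝ≥0∞) * ∫⁻ y, ‖y.1 - y.2‖ₑ ^ 2 ∂(γ j) = ENNReal.ofReal V := by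
    rw [← hcostV, ENNReal.ofReal_sum_of_nonneg fun j _ => mul_nonneg (lam j).coe_nonneg
      (integral_nonneg fun _ => by positivity)]
    refine Finset.sum_congr rfl fun j _ => ?_
    rw [hcost, ENNReal.ofReal_mul (lam j).coe_nonneg, ENNReal.ofReal_coe_nnreal]
  have hmm : mmW2sq lam g = ENNReal.ofReal V := by
    apply le_antisymm
    -- All marginals are driven by one `z` of law `ν`. The weighted mean of the points `a j z` is
    -- `z`, so the cost is that of the plans `γ j`.
    · have hc : ν.map (fun z j => a j z) ∈ multiCouplings g := by
        refine ⟨Measure.isProbabilityMeasure_map (by fun_prop), fun j => ?_⟩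
        rw [← hmap j, Measure.map_map (by fun_prop) (by fun_prop)]
        rfl
      refine (iInf₂_le _ hc).trans ?_
      simp_rw [multiCost_eq_ofReal lam hlam]
      rw [lintegral_map (by fun_prop) (by fun_prop), ← hcostV]
      have hbar : ∀ z, ∑ i, (lam i : ℝ) • a i z = z := by
        intro z
        simp only [ha, smul_add, Finset.sum_add_distrib, hT, ← hmb]
        abel
      simp_rw [hbar]
      rw [← ofReal_integral_eq_lintegral_ofReal]
      · rw [integral_finsetSum _ fun j _ => (haL j).integrable_sq_norm.const_mul _]
        simp_rw [integral_const_mul, le_refl]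
      · exact integrable_finsetSum _ fun j _ => (haL j).integrable_sq_norm.const_mul _
      · exact Filter.Eventually.of_forall fun z => Finset.sum_nonneg fun j _ => by positivity
    · refine le_iInf₂ fun η hη => ?_
      have := hη.1
      simp_rw [multiCost_eq_ofReal lam hlam]
      have p : ∀ j, MeasurePreserving (fun y : Fin J → Rd d => y j) η (g j) := fun j =>
        ⟨by fun_prop, hη.2 j⟩
      have hL : ∀ j, MemLp (fun y : Fin J → Rd d => y j) 2 η := fun j =>
        (memLp_two_id_of_mem_P2 (hgP2 j)).comp_measurePreserving (p j)
      have hLbar : MemLp (fun y : Fin J → Rd d => ∑ i, (lam i : ℝ) • y i) 2 η :=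
        memLp_finsetSum _ fun i _ => (hL i).const_smul (lam i : ℝ)
      have hci : Integrable (fun y : Fin J → Rd d =>
          ∑ j, (lam j : ℝ) * ‖y j - ∑ i, (lam i : ℝ) • y i‖ ^ 2) η :=
        integrable_finsetSum _ fun j _ => ((hL j).sub hLbar).integrable_sq_norm.const_mul _
      rw [← ofReal_integral_eq_lintegral_ofReal hci
        (Filter.Eventually.of_forall fun z => Finset.sum_nonneg fun j _ => by positivity)]
      refine ENNReal.ofReal_le_ofReal ?_
      have i1 := fun j => integrable_fstPotential (memLp_two_id_of_mem_P2 (hgP2 j)) (m j) mb (B j)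
      have i1' : ∀ j, Integrable (fun y : Fin J → Rd d => fstPotential (m j) mb (B j) (y j)) η :=
        fun j => (p j).integrable_comp_of_integrable (i1 j)
      have e1 : V = ∫ y, ∑ j, (lam j : ℝ) * fstPotential (m j) mb (B j) (y j) ∂η := by
        rw [integral_finsetSum _ fun j _ => (i1' j).const_mul _, hV]
        refine Finset.sum_congr rfl fun j _ => ?_
        rw [integral_const_mul]
        congr 1
        have h := (i1 j).1
        rw [← (p j).map_eq] at h ⊢
        exact integral_map (p j).measurable.aemeasurable h
      rw [e1]
      refine integral_mono (integrable_finsetSum _ fun j _ => (i1' j).const_mul _) hci fun y => ?_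
      simp only
      -- The zero sum of second potentials is inserted at the mean of the `y i`; the duality
      -- inequality then applies to each pair consisting of `y j` and that mean.
      rw [← add_zero (∑ j, (lam j : ℝ) * fstPotential (m j) mb (B j) (y j)),
        ← hpsi (∑ i, (lam i : ℝ) • y i), ← Finset.sum_add_distrib]
      refine Finset.sum_le_sum fun j _ => ?_
      rcases eq_or_lt_of_le (lam j).coe_nonneg with h0 | h0
      · simp [← h0]
      rw [← mul_add]
      refine mul_le_mul_of_nonneg_left ?_ h0.le
      rw [sq_norm_sub_eq_potentials (m j) mb (hB j h0)]
      exact le_add_of_nonneg_right (by positivity)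
  have hlower : ∀ ρ ∈ P2 d, V + ∑ j, (lam j : ℝ) *
      (W2sq ((g j).map (B j)) (ρ.map (fun y => B j (a j y)))).toReal ≤
      ∑ j, (lam j : ℝ) * (W2sq (g j) ρ).toReal := by
    intro ρ hρ
    rw [← add_zero V, ← hpsi_int ρ hρ, hV, ← Finset.sum_add_distrib, ← Finset.sum_add_distrib]
    refine Finset.sum_le_sum fun j _ => ?_
    rcases eq_or_lt_of_le (lam j).coe_nonneg with h0 | h0
    · simp [← h0]
    rw [← mul_add, ← mul_add]
    exact mul_le_mul_of_nonneg_left (potentials_add_W2sq_le (m j) mb (hB j h0) (hgP2 j) hρ) h0.le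
  have hWreal : ∀ ρ ∈ P2 d, ∑ j, (lam j : ℝ≥0∞) * W2sq (g j) ρ =
      ENNReal.ofReal (∑ j, (lam j : ℝ) * (W2sq (g j) ρ).toReal) := by
    intro ρ hρ
    rw [ENNReal.ofReal_sum_of_nonneg fun j _ => by positivity]
    refine Finset.sum_congr rfl fun j _ => ?_
    rw [ENNReal.ofReal_mul (lam j).coe_nonneg, ENNReal.ofReal_coe_nnreal,
      ENNReal.ofReal_toReal (W2sq_ne_top (hgP2 j) hρ)]
  have hVnn : 0 ≤ V := by
    rw [← hcostV]
    exact Finset.sum_nonneg fun j _ => mul_nonneg (lam j).coe_nonneg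
      (integral_nonneg fun _ => by positivity)
  refine ⟨ν, hν, by rw [hmm]; exact ENNReal.ofReal_ne_top, fun ρ hρ => ?_, fun ρ hρ hle => ?_,
    γ, fun j => ⟨hγc j, hγG j⟩, by rw [hγcost, hmm]⟩
  · rw [hmm, hWreal ρ hρ]
    refine ENNReal.ofReal_le_ofReal (le_trans ?_ (hlower ρ hρ))
    exact le_add_of_nonneg_right (Finset.sum_nonneg fun j _ => by positivity)
  · have := hρ.1
    rw [hmm, hWreal ρ hρ, ENNReal.ofReal_le_ofReal_iff hVnn] at hle
    obtain ⟨j, hj⟩ : ∃ j, 0 < (lam j : ℝ) := by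
      by_contra! h
      have : ∑ j, (lam j : ℝ) ≤ 0 := Finset.sum_nonpos fun j _ => h j
      linarith
    have hBa : Measurable (fun y => B j (a j y)) := (B j).measurable.comp (ham j)
    have hsum : ∑ j, (lam j : ℝ) *
        (W2sq ((g j).map (B j)) (ρ.map (fun y => B j (a j y)))).toReal ≤ 0 := by
      linarith [hlower ρ hρ]
    have hj0 : (W2sq ((g j).map (B j)) (ρ.map (fun y => B j (a j y)))).toReal = 0 := by
      have h1 := (Finset.sum_eq_zero_iff_of_nonneg (fun i _ => by positivity)).mp
        (le_antisymm hsum (Finset.sum_nonneg fun i _ => by positivity)) j (Finset.mem_univ j)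
      exact (mul_eq_zero.mp h1).resolve_left hj.ne'
    have hρL : MemLp (fun y => B j (a j y)) 2 ρ := by
      have h : MemLp (fun z : Rd d => z - mb) 2 ρ :=
        (memLp_two_id_of_mem_P2 hρ).sub (memLp_const mb)
      exact (B j).comp_memLp' ((memLp_const (m j)).add ((T j).comp_memLp' h))
    have hP : ρ.map (fun y => B j (a j y)) ∈ P2 d := by
      refine ⟨Measure.isProbabilityMeasure_map hBa.aemeasurable, ?_⟩
      rw [lintegral_map (by fun_prop) hBa, lintegral_enorm_sq_eq_ofReal hρL]
      exact ENNReal.ofReal_lt_top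
    have := hP.1
    have hW : W2sq ((g j).map (B j)) (ρ.map (fun y => B j (a j y))) = 0 :=
      ((ENNReal.toReal_eq_zero_iff _).mp hj0).resolve_right
        (W2sq_ne_top (mem_P2_of_isGaussian _) hP)
    -- One positively weighted index decides uniqueness: `ν` and `ρ` have the same image under `B j
    -- ∘ a j`, and this map is injective.
    have heq := eq_of_W2sq_eq_zero hW
    rw [← hmap j, Measure.map_map (by fun_prop) (ham j)] at heq
    have hinj : Function.Injective (fun y => B j (a j y)) := by
      intro y y' h
      have h1 : B j (T j (y - y')) = 0 := by
        have h2 : a j y - a j y' = T j (y - y') := by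
          simp only [ha, map_sub]; abel
        rw [← h2, map_sub, sub_eq_zero]; exact h
      have h2 := hB j hj (y - y') (y - y')
      rw [h1, inner_zero_right] at h2
      exact sub_eq_zero.mp (inner_self_eq_zero.mp h2.symm)
    have hemb : MeasurableEmbedding (fun y => B j (a j y)) := hBa.measurableEmbedding hinj
    have h3 : (ν.map (fun y => B j (a j y))).comap (fun y => B j (a j y)) =
        (ρ.map (fun y => B j (a j y))).comap (fun y => B j (a j y)) := by
      rw [← heq]; rfl
    rw [hemb.comap_map, hemb.comap_map] at h3
    exact h3.symm

end GMMOT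

/-! ### Finite transport: minimizers, matching of labels, gluing. -/

section FiniteTransport

lemma IsCompact.exists_forall_sum_mul_le {X : Type*} [Fintype X] {C : Set (X → ℝ≥0)}
    (hC : IsCompact C) (hne : C.Nonempty) (c : X → ℝ≥0∞) (hc : ∀ x, c x ≠ ∞) :
    ∃ w ∈ C, ∀ w' ∈ C, ∑ x, (w x : ℝ≥0∞) * c x ≤ ∑ x, (w' x : ℝ≥0∞) * c x := by
  have hcont : Continuous (fun w : X → ℝ≥0 => ∑ x, (w x : ℝ≥0∞) * c x) :=
    continuous_finsetSum _ fun x _ => (ENNReal.continuous_mul_const (hc x)).comp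
      (ENNReal.continuous_coe.comp (continuous_apply x))
  obtain ⟨w, hw, hmin⟩ := hC.exists_isMinOn hne hcont.continuousOn
  exact ⟨w, hw, fun w' hw' => hmin hw'⟩

/-- Weights with marginals `r` and `p` carried by the pairs with equal labels. -/
lemma exists_coupling_of_fiber_sums_eq {ι κ X : Type*} [Fintype ι] [Fintype κ] [DecidableEq X]
    (f : ι → X) (g : κ → X) (r : ι → ℝ≥0) (p : κ → ℝ≥0)
    (h : ∀ x, ∑ i with f i = x, r i = ∑ a with g a = x, p a) :
    ∃ u : ι → κ → ℝ≥0, (∀ i, ∑ a, u i a = r i) ∧ (∀ a, ∑ i, u i a = p a) ∧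
      ∀ i a, u i a ≠ 0 → f i = g a := by
  -- The product coupling inside each label class, normalized by the common class mass. In a class
  -- of mass zero all weights vanish and division by zero returns the required `0`.
  refine ⟨fun i a => if f i = g a then r i * p a / ∑ b with g b = g a, p b else 0, ?_, ?_, ?_⟩
  · intro i
    rw [← Finset.sum_filter]
    have h1 : ∀ a ∈ Finset.univ.filter (fun a => f i = g a),
        r i * p a / ∑ b with g b = g a, p b = r i / (∑ b with g b = f i, p b) * p a := by
      intro a ha
      rw [(Finset.mem_filter.mp ha).2, mul_div_right_comm]
    rw [Finset.sum_congr rfl h1, ← Finset.mul_sum]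
    simp_rw [eq_comm (a := f i)]
    by_cases h0 : ∑ b with g b = f i, p b = 0
    · rw [h0, mul_zero]
      rw [← h] at h0
      exact ((Finset.sum_eq_zero_iff.mp h0) i (by simp)).symm
    · exact div_mul_cancel₀ _ h0
  · intro a
    rw [← Finset.sum_filter]
    simp_rw [mul_div_assoc]
    rw [← Finset.sum_mul, h]
    by_cases h0 : ∑ b with g b = g a, p b = 0
    · rw [h0, zero_mul]
      exact ((Finset.sum_eq_zero_iff.mp h0) a (by simp)).symm
    · exact mul_div_cancel₀ _ h0
  · intro i a hne
    by_contra hc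
    exact hne (if_neg hc)

/-- Independent gluing of weights `u j : κ j → ℝ≥0` with the same total mass `q`. -/
noncomputable def glueWeights {ι : Type*} [Fintype ι] {κ : ι → Type*} (q : ℝ≥0)
    (u : (j : ι) → κ j → ℝ≥0) (k : (j : ι) → κ j) : ℝ≥0 :=
  q * ∏ j, (u j (k j) / q)

lemma sum_glueWeights {ι : Type*} [Fintype ι] [DecidableEq ι] {κ : ι → Type*}
    [∀ j, Fintype (κ j)] [∀ j, DecidableEq (κ j)] (q : ℝ≥0) (u : (j : ι) → κ j → ℝ≥0)
    (hu : ∀ j, ∑ a, u j a = q) (j : ι) (a : κ j) :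
    ∑ k with k j = a, glueWeights q u k = u j a := by
  by_cases hq : q = 0
  · have : u j a = 0 := by
      have := hu j
      rw [hq, Finset.sum_eq_zero_iff] at this
      exact this a (Finset.mem_univ a)
    rw [this]
    exact Finset.sum_eq_zero fun k _ => by simp [glueWeights, hq]
  have hfil : (Finset.univ.filter fun k : (j : ι) → κ j => k j = a) =
      Fintype.piFinset (Function.update (fun i => (Finset.univ : Finset (κ i))) j {a}) := by
    ext k
    simp only [Finset.mem_filter, Finset.mem_univ, true_and, Fintype.mem_piFinset]
    constructor
    · intro hk i
      by_cases hi : i = j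
      · subst hi; simp [hk]
      · simp [Function.update_of_ne hi]
    · intro hk
      simpa using hk j
  simp only [glueWeights]
  rw [← Finset.mul_sum, hfil, ← Finset.prod_univ_sum (fun i => Function.update
    (fun i => (Finset.univ : Finset (κ i))) j {a} i) (fun i b => u i b / q),
    ← Finset.mul_prod_erase _ _ (Finset.mem_univ j), Function.update_self, Finset.sum_singleton,
    Finset.prod_eq_one, mul_one, mul_div_cancel₀ _ hq]
  intro i hi
  rw [Function.update_of_ne (Finset.ne_of_mem_erase hi), ← Finset.sum_div, hu i, div_self hq]

end FiniteTransport

/-! ### The discrete program and its sparse solutions. -/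

namespace GMMOT

variable {d J : ℕ} {K : Fin J → ℕ}

lemma isCompact_discreteCouplings (hJ : 0 < J) (p : (j : Fin J) → Fin (K j) → ℝ≥0) :
    IsCompact (discreteCouplings p) := by
  have hclosed : IsClosed (discreteCouplings p) := by
    have : discreteCouplings p = ⋂ (j) (a), {w | ∑ k with k j = a, w k = p j a} := by
      ext; simp [discreteCouplings]
    rw [this]
    exact isClosed_iInter fun j => isClosed_iInter fun a =>
      isClosed_eq (by fun_prop) continuous_const
  refine IsCompact.of_isClosed_subset
    (isCompact_univ_pi fun k => isCompact_Icc (a := 0) (b := p ⟨0, hJ⟩ (k ⟨0, hJ⟩))) hclosed ?_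
  intro w hw k _
  refine ⟨zero_le, ?_⟩
  rw [← hw]
  exact Finset.single_le_sum (fun _ _ => zero_le) (by simp)

lemma discreteCouplings_nonempty {p : (j : Fin J) → Fin (K j) → ℝ≥0}
    (hp : ∀ j, ∑ a, p j a = 1) : (discreteCouplings p).Nonempty :=
  ⟨glueWeights 1 p, sum_glueWeights 1 p hp⟩

/-- A large set of multi-indices carries a nonzero tensor whose marginals all vanish. -/
lemma exists_marginal_free_direction (hK : ∀ j, 0 < K j) (s : Finset ((j : Fin J) → Fin (K j)))
    (hs : (∑ j, K j) + 1 < s.card + J) :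
    ∃ h : ((j : Fin J) → Fin (K j)) → ℝ, h ≠ 0 ∧ (∀ k ∉ s, h k = 0) ∧ ∑ k, h k = 0 ∧
      ∀ (j : Fin J) (a : Fin (K j)), ∑ k with k j = a, h k = 0 := by
  classical
  let a₀ : (j : Fin J) → Fin (K j) := fun j => ⟨0, hK j⟩
  -- `none` records the total mass; one marginal constraint per `j` is then redundant. This leaves
  -- `∑ (K j - 1) + 1` equations, fewer than the unknowns.
  let I := Option (Σ j : Fin J, {a : Fin (K j) // a ≠ a₀ j})
  let ext : (s → ℝ) → ((j : Fin J) → Fin (K j)) → ℝ :=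
    fun h k => if hk : k ∈ s then h ⟨k, hk⟩ else 0
  let Φ : (s → ℝ) →ₗ[ℝ] (I → ℝ) :=
    { toFun := fun h i => match i with
        | none => ∑ k, ext h k
        | some ⟨j, a⟩ => ∑ k with k j = a.1, ext h k
      map_add' := by
        intro h h'
        have : ∀ k, ext (h + h') k = ext h k + ext h' k := fun k => by
          simp only [ext]; split_ifs <;> simp
        funext i
        rcases i with _ | ⟨j, a⟩ <;> simp [this, Finset.sum_add_distrib]
      map_smul' := by
        intro c h
        have : ∀ k, ext (c • h) k = c * ext h k := fun k => by
          simp only [ext]; split_ifs <;> simp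
        funext i
        rcases i with _ | ⟨j, a⟩ <;> simp [this, Finset.mul_sum] }
  have hcard : Fintype.card I + J = (∑ j, K j) + 1 := by
    have h1 : Fintype.card I = ∑ j : Fin J, (K j - 1) + 1 := by
      simp only [I, Fintype.card_option, Fintype.card_sigma]
      congr 1
      refine Finset.sum_congr rfl fun j _ => ?_
      rw [Fintype.card_subtype_compl, Fintype.card_fin, Fintype.card_subtype_eq]
    have h2 : ∑ j : Fin J, (K j - 1) + J = ∑ j, K j := by
      have h3 : ∑ j : Fin J, (K j - 1 + 1) = ∑ j, K j :=
        Finset.sum_congr rfl fun j _ => Nat.sub_add_cancel (hK j)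
      rw [Finset.sum_add_distrib] at h3
      simpa using h3
    omega
  have hker : LinearMap.ker Φ ≠ ⊥ := by
    refine Φ.ker_ne_bot_of_finrank_lt ?_
    rw [Module.finrank_fintype_fun_eq_card, Module.finrank_fintype_fun_eq_card, Fintype.card_coe]
    omega
  obtain ⟨h, hh, hne⟩ := (Submodule.ne_bot_iff _).mp hker
  rw [LinearMap.mem_ker] at hh
  have htot : ∑ k, ext h k = 0 := congrFun hh none
  have hmarg : ∀ (j : Fin J) (a : Fin (K j)), a ≠ a₀ j → ∑ k with k j = a, ext h k = 0 :=
    fun j a ha => congrFun hh (some ⟨j, a, ha⟩)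
  refine ⟨ext h, ?_, fun k hk => by simp [ext, hk], htot, fun j a => ?_⟩
  · intro h0
    refine hne (funext fun k => ?_)
    have := congrFun h0 k.1
    simpa [ext] using this
  -- The omitted marginal vanishes because the total and all other marginals do.
  · by_cases ha : a = a₀ j
    · rw [← Finset.sum_fiberwise (g := fun k => k j), Finset.sum_eq_single (a₀ j)] at htot
      · rw [ha]; exact htot
      · intro b _ hb
        exact hmarg j b hb
      · simp
    · exact hmarg j a ha

lemma discreteCost_eq_ofReal {lam : Fin J → ℝ≥0} {g : (j : Fin J) → Fin (K j) → Measure (Rd d)}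
    (hfin : ∀ k : (j : Fin J) → Fin (K j), mmW2sq lam (fun j => g j (k j)) ≠ ∞)
    (w : ((j : Fin J) → Fin (K j)) → ℝ≥0) :
    discreteCost lam g w =
      ENNReal.ofReal (∑ k, (w k : ℝ) * (mmW2sq lam (fun j => g j (k j))).toReal) := by
  rw [discreteCost, ENNReal.ofReal_sum_of_nonneg fun k _ => by positivity]
  refine Finset.sum_congr rfl fun k _ => ?_
  rw [ENNReal.ofReal_mul (w k).coe_nonneg, ENNReal.ofReal_coe_nnreal,
    ENNReal.ofReal_toReal (hfin k)]

/-- An admissible tensor with too many nonzero coefficients can be replaced by one with fewer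
nonzero coefficients, at no additional cost. -/
lemma exists_discreteCoupling_card_lt {lam : Fin J → ℝ≥0}
    {p : (j : Fin J) → Fin (K j) → ℝ≥0} {g : (j : Fin J) → Fin (K j) → Measure (Rd d)}
    (hfin : ∀ k : (j : Fin J) → Fin (K j), mmW2sq lam (fun j => g j (k j)) ≠ ∞)
    (hK : ∀ j, 0 < K j) {w : ((j : Fin J) → Fin (K j)) → ℝ≥0} (hw : w ∈ discreteCouplings p)
    (hcard : (∑ j, K j) + 1 < (Finset.univ.filter (fun k => w k ≠ 0)).card + J) :
    ∃ w' ∈ discreteCouplings p, discreteCost lam g w' ≤ discreteCost lam g w ∧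
      (Finset.univ.filter (fun k => w' k ≠ 0)).card <
        (Finset.univ.filter (fun k => w k ≠ 0)).card := by
  set c : ((j : Fin J) → Fin (K j)) → ℝ := fun k => (mmW2sq lam (fun j => g j (k j))).toReal
  obtain ⟨h, hne, hsupp, htot, hmarg, hcost⟩ : ∃ h : ((j : Fin J) → Fin (K j)) → ℝ, h ≠ 0 ∧
      (∀ k, w k = 0 → h k = 0) ∧ ∑ k, h k = 0 ∧
      (∀ (j : Fin J) (a : Fin (K j)), ∑ k with k j = a, h k = 0) ∧ ∑ k, h k * c k ≤ 0 := by
    obtain ⟨h, hne, hsupp, htot, hmarg⟩ := exists_marginal_free_direction hK _ hcard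
    have hsupp' : ∀ k, w k = 0 → h k = 0 := fun k hk => hsupp k (by simp [hk])
    -- Either sign of `h` preserves the marginals, so a direction that does not raise the cost is
    -- available.
    rcases le_total (∑ k, h k * c k) 0 with hle | hle
    · exact ⟨h, hne, hsupp', htot, hmarg, hle⟩
    · exact ⟨-h, neg_ne_zero.mpr hne, fun k hk => by simp [hsupp' k hk], by simp [htot],
        fun j a => by simp [hmarg j a], by simpa using hle⟩
  obtain ⟨k₁, hk₁⟩ : ∃ k, h k < 0 := by
    by_contra! hnn
    exact hne (funext fun k => (Finset.sum_eq_zero_iff_of_nonneg fun k _ => hnn k).mp htot k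
      (Finset.mem_univ k))
  -- The ratio test: the smallest ratio is the longest step keeping all coefficients nonnegative,
  -- and it annihilates the coefficient at `k₀`.
  obtain ⟨k₀, hk₀, hmin⟩ := Finset.exists_min_image (Finset.univ.filter (fun k => h k < 0))
    (fun k => (w k : ℝ) / (-h k)) ⟨k₁, by simp [hk₁]⟩
  have hk₀neg : h k₀ < 0 := (Finset.mem_filter.mp hk₀).2
  set t : ℝ := (w k₀ : ℝ) / (-h k₀) with ht
  have htnn : 0 ≤ t := div_nonneg (w k₀).coe_nonneg (by linarith)
  have hnn : ∀ k, 0 ≤ (w k : ℝ) + t * h k := by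
    intro k
    rcases lt_or_ge (h k) 0 with hk | hk
    · have h1 := hmin k (by simp [hk])
      rw [le_div_iff₀ (by linarith)] at h1
      linarith
    · have := mul_nonneg htnn hk
      positivity
  have hzero : (w k₀ : ℝ) + t * h k₀ = 0 := by
    rw [ht, div_neg, neg_mul, div_mul_cancel₀ _ hk₀neg.ne]; ring
  let w' : ((j : Fin J) → Fin (K j)) → ℝ≥0 := fun k => ⟨(w k : ℝ) + t * h k, hnn k⟩
  have hw' : ∀ k, (w' k : ℝ) = (w k : ℝ) + t * h k := fun k => rfl
  refine ⟨w', fun j a => ?_, ?_, ?_⟩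
  · have h1 : ∑ k with k j = a, (w k : ℝ) = p j a := by exact_mod_cast hw j a
    have h2 : ∑ k with k j = a, (w' k : ℝ) = p j a := by
      simp_rw [hw', Finset.sum_add_distrib, ← Finset.mul_sum, hmarg, mul_zero, add_zero, h1]
    exact_mod_cast h2
  · rw [discreteCost_eq_ofReal hfin, discreteCost_eq_ofReal hfin]
    refine ENNReal.ofReal_le_ofReal ?_
    simp_rw [hw', add_mul, Finset.sum_add_distrib, mul_assoc, ← Finset.mul_sum]
    have := mul_nonpos_of_nonneg_of_nonpos htnn hcost
    linarith
  · refine Finset.card_lt_card ⟨fun k hk => ?_, fun hsub => ?_⟩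
    · simp only [Finset.mem_filter, Finset.mem_univ, true_and] at hk ⊢
      intro h0
      refine hk (NNReal.coe_injective ?_)
      rw [hw', h0, hsupp k h0]
      simp
    · have h1 : k₀ ∈ Finset.univ.filter (fun k => w k ≠ 0) := by
        simp only [Finset.mem_filter, Finset.mem_univ, true_and]
        exact fun h0 => hk₀neg.ne (hsupp k₀ h0)
      exact (Finset.mem_filter.mp (hsub h1)).2 (NNReal.coe_injective (by rw [hw', hzero]; simp))

lemma exists_isOptimalDiscrete {lam : Fin J → ℝ≥0} (hJ : 0 < J)
    {p : (j : Fin J) → Fin (K j) → ℝ≥0} (hp : ∀ j, ∑ a, p j a = 1)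
    {g : (j : Fin J) → Fin (K j) → Measure (Rd d)}
    (hfin : ∀ k : (j : Fin J) → Fin (K j), mmW2sq lam (fun j => g j (k j)) ≠ ∞) :
    ∃ w, IsOptimalDiscrete lam p g w :=
  (isCompact_discreteCouplings hJ p).exists_forall_sum_mul_le (discreteCouplings_nonempty hp) _ hfin

/-- The discrete multi-marginal program has a sparse solution. -/
theorem exists_sparse_isOptimalDiscrete {lam : Fin J → ℝ≥0} (hJ : 0 < J)
    {p : (j : Fin J) → Fin (K j) → ℝ≥0} (hp : ∀ j, ∑ a, p j a = 1)
    {g : (j : Fin J) → Fin (K j) → Measure (Rd d)}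
    (hfin : ∀ k : (j : Fin J) → Fin (K j), mmW2sq lam (fun j => g j (k j)) ≠ ∞) :
    ∃ w, IsOptimalDiscrete lam p g w ∧
      (Finset.univ.filter (fun k => w k ≠ 0)).card + J ≤ (∑ j, K j) + 1 := by
  obtain ⟨w, hw, hmin⟩ := WellFounded.has_min
    (measure fun w : ((j : Fin J) → Fin (K j)) → ℝ≥0 =>
      (Finset.univ.filter (fun k => w k ≠ 0)).card).wf
    {w | IsOptimalDiscrete lam p g w} (exists_isOptimalDiscrete hJ hp hfin)
  refine ⟨w, hw, ?_⟩
  by_contra! hcard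
  have hK : ∀ j, 0 < K j := by
    intro j
    by_contra! h0
    have : IsEmpty (Fin (K j)) := by
      rw [Nat.le_zero.mp h0]; infer_instance
    have h1 := hp j
    simp at h1
  obtain ⟨w', hw'p, hle, hlt⟩ := exists_discreteCoupling_card_lt hfin hK hw.1 hcard
  exact hmin w' ⟨hw'p, fun v hv => hle.trans (hw.2 v hv)⟩ hlt

end GMMOT

/-! ### Reduction of `MW₂²` to transport between components. -/

namespace GMMOT

variable {d J : ℕ}

lemma map_sum_smul {Ω Ω' X : Type*} [MeasurableSpace Ω] [MeasurableSpace Ω'] [Fintype X]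
    (r : X → ℝ≥0) (G : X → Measure Ω) {f : Ω → Ω'} (hf : Measurable f) :
    (∑ i, r i • G i).map f = ∑ i, r i • (G i).map f := by
  rw [← Measure.mapₗ_apply_of_measurable hf, map_sum]
  refine Finset.sum_congr rfl fun i _ => ?_
  rw [Measure.mapₗ_apply_of_measurable hf, Measure.map_smul]

/-- Nonnegative matrices with row sums `p` and column sums `q`. -/
def pairCouplings {κ η : Type*} [Fintype κ] [Fintype η] (p : κ → ℝ≥0) (q : η → ℝ≥0) :
    Set (κ × η → ℝ≥0) :=
  {w | (∀ a, ∑ l, w (a, l) = p a) ∧ ∀ l, ∑ a, w (a, l) = q l}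

section PairCouplings

variable {κ η : Type*} [Fintype κ] [Fintype η]

lemma isCompact_pairCouplings (p : κ → ℝ≥0) (q : η → ℝ≥0) : IsCompact (pairCouplings p q) := by
  have hclosed : IsClosed (pairCouplings p q) := by
    have : pairCouplings p q = (⋂ a, {w | ∑ l, w (a, l) = p a}) ∩
        ⋂ l, {w | ∑ a, w (a, l) = q l} := by
      ext; simp [pairCouplings]
    rw [this]
    exact (isClosed_iInter fun a => isClosed_eq (by fun_prop) continuous_const).inter
      (isClosed_iInter fun l => isClosed_eq (by fun_prop) continuous_const)
  refine IsCompact.of_isClosed_subset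
    (isCompact_univ_pi fun k : κ × η => isCompact_Icc (a := 0) (b := p k.1)) hclosed ?_
  intro w hw k _
  refine ⟨zero_le, ?_⟩
  rw [← hw.1]
  exact Finset.single_le_sum (f := fun l => w (k.1, l)) (fun _ _ => zero_le) (Finset.mem_univ k.2)

lemma pairCouplings_nonempty {p : κ → ℝ≥0} {q : η → ℝ≥0} (hp : ∑ a, p a = 1)
    (hq : ∑ l, q l = 1) : (pairCouplings p q).Nonempty :=
  ⟨fun k => p k.1 * q k.2, fun a => by simp [← Finset.mul_sum, hq],
    fun l => by simp [← Finset.sum_mul, hp]⟩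

/-- A transport plan between Gaussian mixtures that is itself a Gaussian mixture costs at least as
much as some transport plan between the components. -/
lemma exists_pairCoupling_le_of_gaussianMixture {p : κ → ℝ≥0} {q : η → ℝ≥0}
    {g : κ → Measure (Rd d)} {ν : η → Measure (Rd d)} (hg : ∀ a, IsGaussian (g a))
    (hν : ∀ l, IsGaussian (ν l)) {γ : Measure (Rd d × Rd d)}
    (hγ : γ ∈ couplings (∑ a, p a • g a) (∑ l, q l • ν l)) (hγG : γ ∈ GMMInf (Rd d × Rd d)) :
    ∃ w ∈ pairCouplings p q,
      ∑ k, (w k : ℝ≥0∞) * W2sq (g k.1) (ν k.2) ≤ ∫⁻ y, ‖y.1 - y.2‖ₑ ^ 2 ∂γ := by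
  classical
  simp only [GMMInf, GMM, Set.mem_iUnion, Set.mem_ofPred_eq] at hγG
  obtain ⟨N, r, G, -, hG, rfl⟩ := hγG
  have h1 : ∑ i, r i • (G i).map Prod.fst = ∑ a, p a • g a := by
    rw [← hγ.2.1, map_sum_smul r G measurable_fst]
  have h2 : ∑ i, r i • (G i).map Prod.snd = ∑ l, q l • ν l := by
    rw [← hγ.2.2, map_sum_smul r G measurable_snd]
  have hG1 : ∀ i, IsGaussian ((G i).map Prod.fst) := fun i =>
    isGaussian_map (ContinuousLinearMap.fst ℝ (Rd d) (Rd d))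
  have hG2 : ∀ i, IsGaussian ((G i).map Prod.snd) := fun i =>
    isGaussian_map (ContinuousLinearMap.snd ℝ (Rd d) (Rd d))
  -- Components may repeat, so identifiability fixes only the total weight of each Gaussian. The
  -- weight `r i` is therefore distributed over all equal components.
  obtain ⟨u, hur, hup, hu⟩ := exists_coupling_of_fiber_sums_eq _ g r p
    (gaussianMixture_weights_eq r _ p g hG1 hg h1)
  obtain ⟨v, hvr, hvq, hv⟩ := exists_coupling_of_fiber_sums_eq _ ν r q
    (gaussianMixture_weights_eq r _ q ν hG2 hν h2)
  have hu0 : ∀ i a, r i = 0 → u i a = 0 := fun i a h0 => by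
    have := hur i
    rw [h0, Finset.sum_eq_zero_iff] at this
    exact this a (Finset.mem_univ a)
  have hv0 : ∀ i l, r i = 0 → v i l = 0 := fun i l h0 => by
    have := hvr i
    rw [h0, Finset.sum_eq_zero_iff] at this
    exact this l (Finset.mem_univ l)
  -- The two distributions of `r i` are coupled independently given `i`. Each `G i` is a plan
  -- between its own marginals, so its cost bounds their `W2sq`.
  refine ⟨fun k => ∑ i, u i k.1 * v i k.2 / r i, ⟨fun a => ?_, fun l => ?_⟩, ?_⟩
  · rw [Finset.sum_comm, ← hup a]
    refine Finset.sum_congr rfl fun i _ => ?_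
    dsimp only
    rw [← Finset.sum_div, ← Finset.mul_sum, hvr]
    by_cases h0 : r i = 0
    · simp [h0, hu0 i a h0]
    · exact mul_div_cancel_right₀ _ h0
  · rw [Finset.sum_comm, ← hvq l]
    refine Finset.sum_congr rfl fun i _ => ?_
    dsimp only
    rw [← Finset.sum_div, ← Finset.sum_mul, hur]
    by_cases h0 : r i = 0
    · simp [h0, hv0 i l h0]
    · exact mul_div_cancel_left₀ _ h0
  · rw [lintegral_finsetSum_measure]
    have h3 : ∑ k : κ × η, ((∑ i, u i k.1 * v i k.2 / r i : ℝ≥0) : ℝ≥0∞) *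
        W2sq (g k.1) (ν k.2) =
        ∑ i, (r i : ℝ≥0∞) * W2sq ((G i).map Prod.fst) ((G i).map Prod.snd) := by
      simp_rw [ENNReal.ofNNReal_finsetSum, Finset.sum_mul]
      rw [Finset.sum_comm]
      refine Finset.sum_congr rfl fun i _ => ?_
      have h4 : ∀ k : κ × η, ((u i k.1 * v i k.2 / r i : ℝ≥0) : ℝ≥0∞) * W2sq (g k.1) (ν k.2) =
          ((u i k.1 * v i k.2 / r i : ℝ≥0) : ℝ≥0∞) *
            W2sq ((G i).map Prod.fst) ((G i).map Prod.snd) := by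
        intro k
        by_cases hu' : u i k.1 = 0
        · simp [hu']
        by_cases hv' : v i k.2 = 0
        · simp [hv']
        rw [hu i k.1 hu', hv i k.2 hv']
      simp_rw [h4]
      rw [← Finset.sum_mul, ← ENNReal.ofNNReal_finsetSum]
      congr 2
      rw [Fintype.sum_prod_type]
      simp_rw [← Finset.sum_div, ← Finset.mul_sum, hvr, ← Finset.sum_mul, hur]
      by_cases h0 : r i = 0
      · simp [h0]
      · exact mul_div_cancel_right₀ _ h0
    rw [h3]
    refine Finset.sum_le_sum fun i _ => ?_
    rw [lintegral_smul_measure]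
    have := hG i
    refine mul_le_mul_right (iInf₂_le _ ⟨inferInstance, rfl, rfl⟩) _

/-- Taking a minimizer of the finite program gives one `w` that works for every Gaussian mixture
plan, hence for their infimum. -/
lemma exists_pairCoupling_le_MW2sq {p : κ → ℝ≥0} {q : η → ℝ≥0}
    (hp : ∑ a, p a = 1) (hq : ∑ l, q l = 1)
    {g : κ → Measure (Rd d)} {ν : η → Measure (Rd d)} (hg : ∀ a, IsGaussian (g a))
    (hν : ∀ l, IsGaussian (ν l)) :
    ∃ w ∈ pairCouplings p q, ∑ k, (w k : ℝ≥0∞) * W2sq (g k.1) (ν k.2) ≤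
      MW2sq (∑ a, p a • g a) (∑ l, q l • ν l) := by
  obtain ⟨w, hw, hmin⟩ := (isCompact_pairCouplings p q).exists_forall_sum_mul_le
    (pairCouplings_nonempty hp hq) (fun k => W2sq (g k.1) (ν k.2))
    (fun k => W2sq_ne_top (mem_P2_of_isGaussian _) (mem_P2_of_isGaussian _))
  refine ⟨w, hw, le_iInf₂ fun γ hγ => ?_⟩
  obtain ⟨w', hw', hle⟩ := exists_pairCoupling_le_of_gaussianMixture hg hν hγ.1 hγ.2
  exact (hmin w' hw').trans hle

end PairCouplings

lemma sum_smul_mem_GMMInf {E : Type*} [TopologicalSpace E] [AddCommMonoid E] [Module ℝ E]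
    [MeasurableSpace E] {X : Type*} [Fintype X] (w : X → ℝ≥0) (hw : ∑ x, w x = 1)
    (ν : X → Measure E) (hν : ∀ x, IsGaussian (ν x)) : ∑ x, w x • ν x ∈ GMMInf E := by
  simp only [GMMInf, GMM, Set.mem_iUnion, Set.mem_ofPred_eq]
  let e := Fintype.equivFin X
  refine ⟨Fintype.card X, w ∘ e.symm, ν ∘ e.symm, ?_, fun k => hν _, ?_⟩
  · rw [← hw]; exact Equiv.sum_comp e.symm w
  · exact (Equiv.sum_comp e.symm fun x => w x • ν x).symm

variable {K : Fin J → ℕ}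

/-- Module-valued so that the same marginal identity serves measures, masses and extended costs. -/
lemma sum_smul_comp_eval {p : (j : Fin J) → Fin (K j) → ℝ≥0}
    {w : ((j : Fin J) → Fin (K j)) → ℝ≥0} (hw : w ∈ discreteCouplings p) (j : Fin J)
    {M : Type*} [AddCommMonoid M] [Module ℝ≥0 M] (f : Fin (K j) → M) :
    ∑ k, w k • f (k j) = ∑ a, p j a • f a := by
  rw [← Finset.sum_fiberwise (g := fun k => k j)]
  refine Finset.sum_congr rfl fun a _ => ?_
  rw [← hw j a, Finset.sum_smul]
  refine Finset.sum_congr rfl fun k hk => ?_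
  rw [(Finset.mem_filter.mp hk).2]

lemma sum_eq_one_of_mem_discreteCouplings (hJ : 0 < J) {p : (j : Fin J) → Fin (K j) → ℝ≥0}
    (hp : ∀ j, ∑ a, p j a = 1) {w : ((j : Fin J) → Fin (K j)) → ℝ≥0}
    (hw : w ∈ discreteCouplings p) : ∑ k, w k = 1 := by
  have := sum_smul_comp_eval hw ⟨0, hJ⟩ (fun _ => (1 : ℝ≥0))
  simpa [hp] using this

end GMMOT

lemma ENNReal.le_of_sum_le_sum {X : Type*} [Fintype X] {f g : X → ℝ≥0∞} (hle : ∀ x, f x ≤ g x)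
    (hsum : ∑ x, g x ≤ ∑ x, f x) (hfin : ∑ x, f x ≠ ∞) (x : X) : g x ≤ f x := by
  classical
  rw [← Finset.add_sum_erase _ f (Finset.mem_univ x)] at hsum hfin
  rw [← Finset.add_sum_erase _ g (Finset.mem_univ x)] at hsum
  have h1 : g x + ∑ y ∈ Finset.univ.erase x, f y ≤ f x + ∑ y ∈ Finset.univ.erase x, f y :=
    le_trans (by gcongr with y; exact hle y) hsum
  exact (ENNReal.add_le_add_iff_right (ENNReal.add_ne_top.mp hfin).2).mp h1

/-! ### Two-sided bounds for the `MW₂` barycenter functional. -/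

namespace GMMOT

variable {d J : ℕ} {K : Fin J → ℕ}

/-- Mixing Gaussian plans of the components gives an upper bound for the `MW₂` barycenter
functional. -/
lemma sum_MW2sq_le_discreteCost (hJ : 0 < J) {lam : Fin J → ℝ≥0}
    {p : (j : Fin J) → Fin (K j) → ℝ≥0} (hp : ∀ j, ∑ a, p j a = 1)
    {g : (j : Fin J) → Fin (K j) → Measure (Rd d)}
    {ν : ((j : Fin J) → Fin (K j)) → Measure (Rd d)}
    {γ : ((j : Fin J) → Fin (K j)) → Fin J → Measure (Rd d × Rd d)}
    (hγ : ∀ k j, γ k j ∈ couplings (g j (k j)) (ν k) ∧ IsGaussian (γ k j))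
    (hcost : ∀ k, ∑ j, (lam j : ℝ≥0∞) * ∫⁻ y, ‖y.1 - y.2‖ₑ ^ 2 ∂(γ k j) =
      mmW2sq lam (fun j => g j (k j)))
    {w : ((j : Fin J) → Fin (K j)) → ℝ≥0} (hw : w ∈ discreteCouplings p) :
    ∑ j, (lam j : ℝ≥0∞) * MW2sq (∑ a, p j a • g j a) (∑ k, w k • ν k) ≤
      discreteCost lam g w := by
  have hw1 := sum_eq_one_of_mem_discreteCouplings hJ hp hw
  have hle : ∀ j, MW2sq (∑ a, p j a • g j a) (∑ k, w k • ν k) ≤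
      ∑ k, (w k : ℝ≥0∞) * ∫⁻ y, ‖y.1 - y.2‖ₑ ^ 2 ∂(γ k j) := by
    intro j
    have hmem : ∑ k, w k • γ k j ∈ couplings (∑ a, p j a • g j a) (∑ k, w k • ν k) := by
      refine ⟨⟨?_⟩, ?_, ?_⟩
      · have : ∀ k, (γ k j) Set.univ = 1 := fun k => by
          have := (hγ k j).1.1
          exact measure_univ
        simp only [Measure.finsetSum_apply, Measure.smul_apply, this, ENNReal.smul_def,
          smul_eq_mul, mul_one]
        exact_mod_cast hw1
      · rw [map_sum_smul _ _ measurable_fst, ← sum_smul_comp_eval hw j (g j)]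
        exact Finset.sum_congr rfl fun k _ => by rw [(hγ k j).1.2.1]
      · rw [map_sum_smul _ _ measurable_snd]
        exact Finset.sum_congr rfl fun k _ => by rw [(hγ k j).1.2.2]
    refine (iInf₂_le _ ⟨hmem, sum_smul_mem_GMMInf w hw1 _ fun k => (hγ k j).2⟩).trans ?_
    rw [lintegral_finsetSum_measure]
    refine (Finset.sum_congr rfl fun k _ => ?_).le
    rw [lintegral_smul_measure]
    rfl
  calc _ ≤ ∑ j, (lam j : ℝ≥0∞) * ∑ k, (w k : ℝ≥0∞) * ∫⁻ y, ‖y.1 - y.2‖ₑ ^ 2 ∂(γ k j) := by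
        gcongr with j; exact hle j
    _ = discreteCost lam g w := by
        simp_rw [discreteCost, ← hcost, Finset.mul_sum]
        rw [Finset.sum_comm]
        exact Finset.sum_congr rfl fun k _ => Finset.sum_congr rfl fun j _ => by ring

/-- The `MW₂` barycenter functional at a Gaussian mixture `ρ` is bounded below by the cost of some
admissible tensor `w`; in case of equality `ρ` is the corresponding mixture of barycenters. -/
lemma exists_discreteCost_le_sum_MW2sq (hJ : 0 < J) {lam : Fin J → ℝ≥0}
    {p : (j : Fin J) → Fin (K j) → ℝ≥0} (hp : ∀ j, ∑ a, p j a = 1)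
    {g : (j : Fin J) → Fin (K j) → Measure (Rd d)} (hg : ∀ j a, IsGaussian (g j a))
    {ν : ((j : Fin J) → Fin (K j)) → Measure (Rd d)}
    (hfin : ∀ k : (j : Fin J) → Fin (K j), mmW2sq lam (fun j => g j (k j)) ≠ ∞)
    (hlow : ∀ k : (j : Fin J) → Fin (K j), ∀ ρ ∈ P2 d, mmW2sq lam (fun j => g j (k j)) ≤
      ∑ j, (lam j : ℝ≥0∞) * W2sq (g j (k j)) ρ)
    (huniq : ∀ k : (j : Fin J) → Fin (K j), ∀ ρ ∈ P2 d,
      ∑ j, (lam j : ℝ≥0∞) * W2sq (g j (k j)) ρ ≤ mmW2sq lam (fun j => g j (k j)) → ρ = ν k)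
    {ρ : Measure (Rd d)} (hρ : ρ ∈ GMMInf (Rd d)) :
    ∃ w ∈ discreteCouplings p,
      discreteCost lam g w ≤ ∑ j, (lam j : ℝ≥0∞) * MW2sq (∑ a, p j a • g j a) ρ ∧
      (∑ j, (lam j : ℝ≥0∞) * MW2sq (∑ a, p j a • g j a) ρ ≤ discreteCost lam g w →
        ρ = ∑ k, w k • ν k) := by
  simp only [GMMInf, GMM, Set.mem_iUnion, Set.mem_ofPred_eq] at hρ
  obtain ⟨N, q, η, hq, hη, rfl⟩ := hρ
  choose u hu hule using fun j => exists_pairCoupling_le_MW2sq (hp j) hq (hg j) hη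
  -- For fixed `l`, every slice `u j (·, l)` has mass `q l`; gluing them independently gives the
  -- joint weight of `l` and `k`.
  let W : Fin N → ((j : Fin J) → Fin (K j)) → ℝ≥0 := fun l =>
    glueWeights (q l) (fun j a => u j (a, l))
  have hW : ∀ l j a, ∑ k with k j = a, W l k = u j (a, l) := fun l j a =>
    sum_glueWeights (q l) (fun j a => u j (a, l)) (fun j => (hu j).2 l) j a
  have hWq : ∀ l, ∑ k, W l k = q l := by
    intro l
    rw [← Finset.sum_fiberwise (g := fun k => k ⟨0, hJ⟩)]
    simp_rw [hW, (hu _).2]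
  have hηP : ∀ l, η l ∈ P2 d := fun l => mem_P2_of_isGaussian _
  let w : ((j : Fin J) → Fin (K j)) → ℝ≥0 := fun k => ∑ l, W l k
  have hw : w ∈ discreteCouplings p := by
    intro j a
    simp only [w]
    rw [Finset.sum_comm]
    simp_rw [hW, (hu j).1]
  have hD : ∑ x : Fin N × ((j : Fin J) → Fin (K j)),
      (W x.1 x.2 : ℝ≥0∞) * ∑ j, (lam j : ℝ≥0∞) * W2sq (g j (x.2 j)) (η x.1) ≤
      ∑ j, (lam j : ℝ≥0∞) * MW2sq (∑ a, p j a • g j a) (∑ l, q l • η l) := by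
    have h1 : ∀ j l, ∑ k, (W l k : ℝ≥0∞) * W2sq (g j (k j)) (η l) =
        ∑ a, (u j (a, l) : ℝ≥0∞) * W2sq (g j a) (η l) := by
      intro j l
      exact sum_smul_comp_eval (p := fun j a => u j (a, l)) (fun j a => hW l j a) j
        (fun a => W2sq (g j a) (η l))
    have h2 : ∀ j, ∑ k, (u j k : ℝ≥0∞) * W2sq (g j k.1) (η k.2) =
        ∑ x : Fin N × ((j : Fin J) → Fin (K j)),
          (W x.1 x.2 : ℝ≥0∞) * W2sq (g j (x.2 j)) (η x.1) := by
      intro j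
      rw [Fintype.sum_prod_type_right, Fintype.sum_prod_type]
      exact Finset.sum_congr rfl fun l _ => (h1 j l).symm
    calc _ = ∑ j, (lam j : ℝ≥0∞) * ∑ k, (u j k : ℝ≥0∞) * W2sq (g j k.1) (η k.2) := by
          simp_rw [h2, Finset.mul_sum]
          rw [Finset.sum_comm]
          exact Finset.sum_congr rfl fun j _ => Finset.sum_congr rfl fun k _ => by ring
      _ ≤ _ := by gcongr with j; exact hule j
  have hcost : discreteCost lam g w = ∑ x : Fin N × ((j : Fin J) → Fin (K j)),
      (W x.1 x.2 : ℝ≥0∞) * mmW2sq lam (fun j => g j (x.2 j)) := by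
    simp_rw [discreteCost, w, Fintype.sum_prod_type, ENNReal.ofNNReal_finsetSum, Finset.sum_mul]
    rw [Finset.sum_comm]
  have hterm : ∀ x : Fin N × ((j : Fin J) → Fin (K j)),
      (W x.1 x.2 : ℝ≥0∞) * mmW2sq lam (fun j => g j (x.2 j)) ≤
        (W x.1 x.2 : ℝ≥0∞) * ∑ j, (lam j : ℝ≥0∞) * W2sq (g j (x.2 j)) (η x.1) := fun x => by
    gcongr; exact hlow x.2 _ (hηP x.1)
  refine ⟨w, hw, ?_, fun hle => ?_⟩
  · rw [hcost]
    exact (Finset.sum_le_sum fun x _ => hterm x).trans hD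
  · have hfin' : discreteCost lam g w ≠ ∞ :=
      ENNReal.sum_ne_top.mpr fun k _ => ENNReal.mul_ne_top ENNReal.coe_ne_top (hfin k)
    -- Equality of finite totals forces equality of every term, so uniqueness of the barycenter
    -- identifies `η l` wherever `W l k` is nonzero.
    have heq : ∀ l k, W l k • η l = W l k • ν k := by
      intro l k
      by_cases h0 : W l k = 0
      · simp [h0]
      have h1 := ENNReal.le_of_sum_le_sum hterm ((hD.trans hle).trans hcost.le)
        (by rw [← hcost]; exact hfin') (l, k)
      rw [ENNReal.mul_le_mul_iff_right (by exact_mod_cast h0) ENNReal.coe_ne_top] at h1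
      rw [huniq k _ (hηP l) h1]
    simp_rw [w, Finset.sum_smul]
    rw [Finset.sum_comm]
    refine Finset.sum_congr rfl fun l _ => ?_
    rw [← hWq l, Finset.sum_smul]
    exact Finset.sum_congr rfl fun k _ => heq l k

end GMMOT

/-! ### Assembly of the three claims. -/

open GMMOT in
theorem mainTheorem6 {d J : ℕ} (lam : Fin J → ℝ≥0) (hlam : ∑ j, lam j = 1)
    (K : Fin J → ℕ) (p : (j : Fin J) → Fin (K j) → ℝ≥0) (hp : ∀ j, ∑ a, p j a = 1)
    (m : (j : Fin J) → Fin (K j) → Rd d)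
    (S : (j : Fin J) → Fin (K j) → Matrix (Fin d) (Fin d) ℝ) (hS : ∀ j a, (S j a).PosDef)
    (g : (j : Fin J) → Fin (K j) → Measure (Rd d))
    (hg : ∀ j a, g j a = multivariateGaussian (m j a) (S j a))
    (μ : Fin J → Measure (Rd d)) (hμ : ∀ j, μ j = ∑ a, p j a • g j a) :
    ∃ ν : ((j : Fin J) → Fin (K j)) → Measure (Rd d),
      -- `ν k` is Gaussian and is the unique `W₂` barycenter of the chosen components
      (∀ k, IsGaussian (ν k) ∧
        ∀ ρ, IsW2Barycenter lam (fun j => g j (k j)) ρ ↔ ρ = ν k) ∧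
      -- the `MW₂` barycenters are the mixtures of the `ν k` with optimal weights
      (∀ ρ, IsMW2Barycenter lam μ ρ ↔
        ∃ w, IsOptimalDiscrete lam p g w ∧ ρ = ∑ k, w k • ν k) ∧
      -- some optimal `w` has at most `K 0 + ⋯ + K (J - 1) - J + 1` nonzero coefficients
      ∃ w, IsOptimalDiscrete lam p g w ∧ IsMW2Barycenter lam μ (∑ k, w k • ν k) ∧
        (Finset.univ.filter (fun k => w k ≠ 0)).card + J ≤ (∑ j, K j) + 1 := by
  have hJ : 0 < J := by
    rcases Nat.eq_zero_or_pos J with rfl | h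
    · simp at hlam
    · exact h
  obtain rfl : μ = fun j => ∑ a, p j a • g j a := funext hμ
  have hgG : ∀ j a, IsGaussian (g j a) := fun j a => by rw [hg]; infer_instance
  choose ν hνG hfin hlow huniq γ hγ hγcost using fun k : (j : Fin J) → Fin (K j) =>
    exists_gaussian_W2Barycenter lam hlam (fun j => m j (k j)) (fun j => S j (k j))
      (fun j => hS j (k j)) (fun j => g j (k j)) (fun j => hg j (k j))
  have hνP : ∀ k, ν k ∈ P2 d := fun k => mem_P2_of_isGaussian _
  have hνcost : ∀ k, ∑ j, (lam j : ℝ≥0∞) * W2sq (g j (k j)) (ν k) ≤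
      mmW2sq lam (fun j => g j (k j)) := fun k => by
    rw [← hγcost k]
    gcongr with j
    exact iInf₂_le _ (hγ k j).1
  have hMW : ∀ w, IsOptimalDiscrete lam p g w →
      IsMW2Barycenter lam (fun j => ∑ a, p j a • g j a) (∑ k, w k • ν k) := by
    intro w hw
    refine ⟨sum_smul_mem_GMMInf w (sum_eq_one_of_mem_discreteCouplings hJ hp hw.1) ν hνG,
      fun ρ hρ => ?_⟩
    obtain ⟨w', hw', hle, -⟩ := exists_discreteCost_le_sum_MW2sq hJ hp hgG hfin hlow huniq hρ
    exact (sum_MW2sq_le_discreteCost hJ hp hγ hγcost hw.1).trans ((hw.2 w' hw').trans hle)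
  obtain ⟨w₀, hw₀, hcard⟩ := exists_sparse_isOptimalDiscrete hJ hp hfin
  refine ⟨ν, fun k => ⟨hνG k, fun ρ => ⟨fun hρ => ?_, ?_⟩⟩, fun ρ => ⟨fun hρ => ?_, ?_⟩,
    w₀, hw₀, hMW w₀ hw₀, hcard⟩
  · exact huniq k ρ hρ.1 ((hρ.2 _ (hνP k)).trans (hνcost k))
  · rintro rfl
    exact ⟨hνP k, fun ρ hρ => (hνcost k).trans (hlow k ρ hρ)⟩
  · obtain ⟨w, hw, hle, heq⟩ := exists_discreteCost_le_sum_MW2sq hJ hp hgG hfin hlow huniq hρ.1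
    -- With `hle` this sandwiches the functional at `ρ` between the costs of `w` and the optimal
    -- `w₀`: `w` is optimal and the equality case applies.
    have hup : ∑ j, (lam j : ℝ≥0∞) * MW2sq (∑ a, p j a • g j a) ρ ≤ discreteCost lam g w₀ :=
      (hρ.2 _ (hMW w₀ hw₀).1).trans (sum_MW2sq_le_discreteCost hJ hp hγ hγcost hw₀.1)
    exact ⟨w, ⟨hw, fun w' hw' => (hle.trans hup).trans (hw₀.2 w' hw')⟩,
      heq (hup.trans (hw₀.2 w hw))⟩
  · rintro ⟨w, hw, rfl⟩
    exact hMW w hw
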